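/- Let $N\ge 1$ be an integer, $s\in(0,1)$, $0<\beta\le N+2s$ and $C_0>0$. Write $\psi_\beta(x)=(1+|x|^2)^{-\beta/2}$, let $$\mathcal L^s(\mathbb R^N)=\Big\{f:\mathbb R^N\to\mathbb R \text{ measurable}:\ \int_{\mathbb R^N}\frac{|f(x)|}{1+|x|^{N+2s}}\,dx<\infty\Big\},$$ and let $$(-\Delta)^s u(x)=C_{N,s}\lim_{\varepsilon\to0^+}\int_{\{|x-y|\ge\varepsilon\}}\frac{u(x)-u(y)}{|x-y|^{N+2s}}\,dy,\qquad C_{N,s}=\frac{2^{2s-1}\,2s\,\Gamma((N+2s)/2)}{\pi^{N/2}\,\Gamma(1-s)},$$ whenever the limit exists and is finite. Then there is a constant $K$, depending only on $N,s,\beta,C_0$, such that the following holds. Let $\rho,c:\mathbb R^N\to\mathbb R$ be continuous with $\rho(x)\ge C_0$ and $c(x)\ge c_0$ for all $x\in\mathbb R^N$, where $c_0>0$ is a constant. Let $p\in[1,\infty)$ satisfy $p\,c_0>K$, and let $u\in C^2(\mathbb R^N)\cap\mathcal L^s(\mathbb R^N)$ be a classical solution of $$\Delta u-(-\Delta)^s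 u-\rho\,c\,u=0\quad\text{in }\mathbb R^N$$ (the equation holds at every point) such that $|u|^p\in\mathcal L^s(\mathbb R^N)$ and $u\in L^p_{\psi_\beta}(\mathbb R^N)$, that is, $\int_{\mathbb R^N}|u|^p\,\psi_\beta\,dx<\infty$. Then $u\equiv0$ in $\mathbb R^N$. -/

import Mathlib

open MeasureTheory Filter Topology

noncomputable section

/-- The normalization constant
`C_{N,s} = 2^{2s-1} 2s Γ((N+2s)/2) / (π^{N/2} Γ(1-s))` of the fractional Laplacian. -/
def fracLapConst (N : ℕ) (s : ℝ) : ℝ :=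
  (2 : ℝ) ^ (2 * s - 1) * (2 * s) * Real.Gamma ((N + 2 * s) / 2) /
    (Real.pi ^ ((N : ℝ) / 2) * Real.Gamma (1 - s))

/-- `HasFracLaplacianAt s u x v`: the principal value
`C_{N,s} lim_{ε → 0⁺} ∫_{|x-y| ≥ ε} (u(x) - u(y)) / |x-y|^{N+2s} dy`
exists, is finite, and equals `v`; that is, `(-Δ)^s u(x) = v`. The sign is the one for which
`(-Δ)^s` has Fourier symbol `|ξ|^{2s}`. -/
def HasFracLaplacianAt {N : ℕ} (s : ℝ) (u : EuclideanSpace ℝ (Fin N) → ℝ)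
    (x : EuclideanSpace ℝ (Fin N)) (v : ℝ) : Prop :=
  Tendsto
    (fun ε : ℝ => fracLapConst N s *
      ∫ y in {y : EuclideanSpace ℝ (Fin N) | ε ≤ ‖x - y‖},
        (u x - u y) / ‖x - y‖ ^ ((N : ℝ) + 2 * s))
    (𝓝[>] 0) (𝓝 v)

/-- The space `𝓛^s(ℝ^N)` of (measurable) functions with
`∫ |f(x)| / (1 + |x|^{N+2s}) dx < ∞`. -/
def MemLs {N : ℕ} (s : ℝ) (f : EuclideanSpace ℝ (Fin N) → ℝ) : Prop :=
  Integrable (fun x => f x / (1 + ‖x‖ ^ ((N : ℝ) + 2 * s)))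

/-- The weighted Lebesgue space `L^p_f(ℝ^N)`, `1 ≤ p < ∞`, of (measurable) functions with
`∫ |u|^p f dx < ∞`. -/
def MemWeightedLp {N : ℕ} (p : ℝ) (f : EuclideanSpace ℝ (Fin N) → ℝ)
    (u : EuclideanSpace ℝ (Fin N) → ℝ) : Prop :=
  AEStronglyMeasurable u ∧ Integrable (fun x => |u x| ^ p * f x)

/-- The weight `ψ_β(x) = (1 + |x|²)^{-β/2}`. -/
def psiWeight {N : ℕ} (β : ℝ) (x : EuclideanSpace ℝ (Fin N)) : ℝ :=
  (1 + ‖x‖ ^ 2) ^ (-β / 2)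

/-- The condition on `ρ`: it is continuous and `ρ(x) ≥ C₀ (1 + |x|²)^{-α/2}`. -/
structure DensityCondition {N : ℕ} (α C₀ : ℝ) (ρ : EuclideanSpace ℝ (Fin N) → ℝ) : Prop where
  continuous : Continuous ρ
  lower_bound : ∀ x, C₀ * (1 + ‖x‖ ^ 2) ^ (-α / 2) ≤ ρ x

/-- The condition on `c`: it is continuous and nonnegative. -/
structure PotentialCondition {N : ℕ} (c : EuclideanSpace ℝ (Fin N) → ℝ) : Prop where
  continuous : Continuous c
  nonneg : ∀ x, 0 ≤ c x

/-- Classical solutions of `Δu - (-Δ)^s u - ρ c u = 0` in `ℝ^N`: functions in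
`C²(ℝ^N) ∩ 𝓛^s(ℝ^N)` that satisfy the equation at every point. -/
structure IsClassicalSolution {N : ℕ} (s : ℝ) (ρ c u : EuclideanSpace ℝ (Fin N) → ℝ) :
    Prop where
  contDiff : ContDiff ℝ 2 u
  memLs : MemLs s u
  equation : ∀ x, ∃ v, HasFracLaplacianAt s u x v ∧
    Laplacian.laplacian u x - v - ρ x * c x * u x = 0

end

/-! ### The polynomial weights and their translates. -/

noncomputable section

/-! Write `L = Δ - (-Δ)^s`, `γ = N + 2s` and `ψ = ψ_γ`, the weight against which functions of `𝓛^s`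
are integrable. Convexity of `t ↦ |t|^p` gives the Kato inequality `p |u|^(p-1) sign(u) L u ≤ L
|u|^p`. By the equation its left side is `p ρ c |u|^p`. Testing with `ψ`, moving `L` onto `ψ` by
symmetry and using `L ψ ≤ K ψ` yields `p C₀ c₀ ∫ |u|^p ψ ≤ K ∫ |u|^p ψ`. If `p c₀ > K / C₀`, the
integral vanishes, and so does `u`.

Two regularizations make this rigorous, since `|u|^p` need not be `C²` and `ψ` is not compactly
supported. First, `L` is replaced by integration of `f(x+z) - f(x)` against a finite symmetric
measure: the kernel truncated at distance `ε`, plus atoms of mass `ε⁻²` at `±ε e_i`. For such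
operators Kato's inequality is pointwise convexity (`IsJumpMeasure.subgradient_mul_jumpOp_le`) and
symmetry is Fubini (`IsJumpMeasure.integral_mul_jumpOp`). The bound by `K ψ` is uniform in `ε`
(`IsJumpMeasure.jumpOp_le`, `isJumpMeasure_mixed`). The limit `ε → 0` is taken only on the `C²`
function `u` (`tendsto_jumpOp_mixed`).

Second, `ψ` is replaced by `(ψ^{1/2} - δ)₊²`, which has compact support and satisfies the same upper
bound on second differences uniformly in `δ` (`psiCutoff_second_difference_le`). The compact support
permits dominated convergence in `ε`; then `δ → 0`. -/

lemma psiWeight_pos {N : ℕ} (γ : ℝ) (x : EuclideanSpace ℝ (Fin N)) : 0 < psiWeight γ x :=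
  Real.rpow_pos_of_pos (by positivity) _

lemma psiWeight_le_one {N : ℕ} {γ : ℝ} (hγ : 0 ≤ γ) (x : EuclideanSpace ℝ (Fin N)) :
    psiWeight γ x ≤ 1 :=
  Real.rpow_le_one_of_one_le_of_nonpos (by nlinarith [sq_nonneg ‖x‖]) (by linarith)

lemma continuous_psiWeight {N : ℕ} (γ : ℝ) :
    Continuous (psiWeight γ : EuclideanSpace ℝ (Fin N) → ℝ) :=
  Continuous.rpow_const (by fun_prop) fun x => Or.inl (by positivity)

/-- If `1 + |y|² ≤ c (1 + |x|²)` then `ψ(x) ≤ c^{γ/2} ψ(y)`. -/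
lemma psiWeight_le_of_le {N : ℕ} {γ c : ℝ} (hγ : 0 ≤ γ) (hc : 0 < c)
    {x y : EuclideanSpace ℝ (Fin N)} (h : 1 + ‖y‖ ^ 2 ≤ c * (1 + ‖x‖ ^ 2)) :
    psiWeight γ x ≤ c ^ (γ / 2) * psiWeight γ y := by
  have hx : (0 : ℝ) < 1 + ‖x‖ ^ 2 := by positivity
  have hy : (0 : ℝ) < 1 + ‖y‖ ^ 2 := by positivity
  have h1 : (c * (1 + ‖x‖ ^ 2)) ^ (-γ / 2) ≤ (1 + ‖y‖ ^ 2) ^ (-γ / 2) :=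
    Real.rpow_le_rpow_of_nonpos hy h (by linarith)
  rw [Real.mul_rpow hc.le hx.le] at h1
  calc psiWeight γ x = c ^ (γ / 2) * (c ^ (-γ / 2) * (1 + ‖x‖ ^ 2) ^ (-γ / 2)) := by
        rw [← mul_assoc, ← Real.rpow_add hc]; simp [psiWeight, neg_div]
    _ ≤ _ := by unfold psiWeight; gcongr

lemma norm_add_sq_le_two {E : Type*} [NormedAddCommGroup E] (x z : E) :
    ‖x + z‖ ^ 2 ≤ 2 * (‖x‖ ^ 2 + ‖z‖ ^ 2) := by
  nlinarith [norm_add_le x z, norm_nonneg (x + z), sq_nonneg (‖x‖ - ‖z‖), norm_nonneg x,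
    norm_nonneg z]

/-- Peetre's inequality for the weight. -/
lemma psiWeight_peetre {N : ℕ} {γ : ℝ} (hγ : 0 ≤ γ) (x z : EuclideanSpace ℝ (Fin N)) :
    psiWeight γ z ≤ (2 * (1 + ‖x‖ ^ 2)) ^ (γ / 2) * psiWeight γ (x + z) := by
  refine psiWeight_le_of_le hγ (by positivity) ?_
  nlinarith [norm_add_sq_le_two x z, mul_nonneg (sq_nonneg ‖x‖) (sq_nonneg ‖z‖)]

lemma psiWeight_add_le {N : ℕ} {γ : ℝ} (hγ : 0 ≤ γ) (x : EuclideanSpace ℝ (Fin N))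
    {z : EuclideanSpace ℝ (Fin N)} (hz : ‖z‖ ≤ 1) :
    psiWeight γ (x + z) ≤ 4 ^ (γ / 2) * psiWeight γ x := by
  refine psiWeight_le_of_le hγ (by norm_num) ?_
  have h := norm_add_sq_le_two (x + z) (-z)
  rw [add_neg_cancel_right, norm_neg] at h
  have : ‖z‖ ^ 2 ≤ 1 := pow_le_one₀ (norm_nonneg _) hz
  nlinarith [sq_nonneg ‖x + z‖]

/-- By the triangle inequality one of `‖z‖`, `‖x + z‖` is at least `‖x‖ / 2`, so the weight there is
at most `4^(γ/2) ψ(x)`. Integrated in `z`, this says that the convolution of `ψ` with itself is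
`O(ψ)`, which controls long jumps. -/
lemma psiWeight_mul_le {N : ℕ} {γ : ℝ} (hγ : 0 ≤ γ) (x z : EuclideanSpace ℝ (Fin N)) :
    psiWeight γ (x + z) * psiWeight γ z ≤
      4 ^ (γ / 2) * psiWeight γ x * (psiWeight γ (x + z) + psiWeight γ z) := by
  have h := norm_add_sq_le_two (x + z) (-z)
  rw [add_neg_cancel_right, norm_neg] at h
  have p1 := psiWeight_pos γ (x + z)
  have p2 := psiWeight_pos γ z
  have p3 : 0 < (4 : ℝ) ^ (γ / 2) * psiWeight γ x := mul_pos (by positivity) (psiWeight_pos γ x)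
  rcases le_total ‖z‖ ‖x + z‖ with hle | hle
  · have : ‖z‖ ^ 2 ≤ ‖x + z‖ ^ 2 := by gcongr
    have := psiWeight_le_of_le hγ (x := x + z) (y := x) (c := 4) (by norm_num) (by linarith)
    nlinarith
  · have : ‖x + z‖ ^ 2 ≤ ‖z‖ ^ 2 := by gcongr
    have := psiWeight_le_of_le hγ (x := z) (y := x) (c := 4) (by norm_num) (by linarith)
    nlinarith

lemma integrable_psiWeight {N : ℕ} {γ : ℝ} (hγ : (N : ℝ) < γ) :
    Integrable (psiWeight γ : EuclideanSpace ℝ (Fin N) → ℝ) :=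
  integrable_rpow_neg_one_add_norm_sq (by simpa using hγ)

/-- Functions of `𝓛^s` are integrable against `ψ_{N+2s}`. -/
lemma MemLs.integrable_mul_psiWeight {N : ℕ} {s : ℝ} (hs : 0 < s)
    {f : EuclideanSpace ℝ (Fin N) → ℝ} (hf : MemLs s f) (hfc : Continuous f) :
    Integrable fun x => f x * psiWeight (N + 2 * s) x := by
  set γ : ℝ := N + 2 * s with hγ
  have hγ0 : 0 < γ := by positivity
  refine Integrable.mono' (hf.norm.const_mul 2)
    (hfc.mul (continuous_psiWeight γ)).aestronglyMeasurable (Eventually.of_forall fun x => ?_)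
  have hpos : 0 < 1 + ‖x‖ ^ γ := by positivity
  have key : psiWeight γ x * (1 + ‖x‖ ^ γ) ≤ 2 := by
    have h1 := psiWeight_le_one hγ0.le x
    have h2 : ‖x‖ ^ γ ≤ (1 + ‖x‖ ^ 2) ^ (γ / 2) := by
      have : ‖x‖ ^ γ = (‖x‖ ^ 2) ^ (γ / 2) := by
        rw [← Real.rpow_natCast, ← Real.rpow_mul (norm_nonneg _)]
        congr 1; push_cast; ring
      rw [this]
      exact Real.rpow_le_rpow (by positivity) (by linarith) (by positivity)
    have h3 : psiWeight γ x * (1 + ‖x‖ ^ 2) ^ (γ / 2) = 1 := by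
      rw [psiWeight, ← Real.rpow_add (by positivity)]
      simp [neg_div]
    nlinarith [psiWeight_pos γ x]
  rw [norm_mul, norm_div, Real.norm_of_nonneg (psiWeight_pos γ x).le,
    Real.norm_of_nonneg hpos.le, ← mul_div_assoc, le_div_iff₀ hpos]
  nlinarith [norm_nonneg (f x)]

/-! ### Taylor bounds for powers and the semiconcave cutoff. -/

/-- Mean value inequality on `[1/4, ∞)`. The threshold `1/4` is a lower bound for `(1 + ‖x + z‖²) /
(1 + ‖x‖²)` when `‖z‖ ≤ 1`. -/
lemma abs_rpow_neg_sub_one_le {b t : ℝ} (hb : 0 ≤ b) (ht : 1 / 4 ≤ t) :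
    |t ^ (-b) - 1| ≤ b * 4 ^ (b + 1) * |t - 1| := by
  have h := Convex.norm_image_sub_le_of_norm_hasDerivWithin_le (f := fun t : ℝ => t ^ (-b))
    (f' := fun t => -b * t ^ (-b - 1)) (C := b * 4 ^ (b + 1)) (s := Set.Ici (1 / 4)) (x := 1)
    (y := t) ?_ ?_ (convex_Ici _) (by norm_num) ht
  · simpa using h
  · intro x hx
    have hx0 : 0 < x := lt_of_lt_of_le (by norm_num) hx
    exact (Real.hasDerivAt_rpow_const (Or.inl hx0.ne')).hasDerivWithinAt
  · intro x hx
    have hx0 : 0 < x := lt_of_lt_of_le (by norm_num) hx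
    rw [norm_mul, norm_neg, Real.norm_of_nonneg hb,
      Real.norm_of_nonneg (Real.rpow_nonneg hx0.le _)]
    gcongr
    calc x ^ (-b - 1) ≤ (1 / 4 : ℝ) ^ (-b - 1) :=
          Real.rpow_le_rpow_of_nonpos (by norm_num) hx (by linarith)
      _ = 4 ^ (b + 1) := by
          rw [one_div, Real.inv_rpow (by norm_num), ← Real.rpow_neg (by norm_num)]
          congr 1; ring

/-- The function `t^(-a) + a (t - 1)` has zero derivative at `1`; the previous lemma with `b = a +
1` bounds its derivative by a multiple of `|t - 1|` on the segment. -/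
lemma rpow_neg_le_quadratic {a t : ℝ} (ha : 0 ≤ a) (ht : 1 / 4 ≤ t) :
    t ^ (-a) ≤ 1 - a * (t - 1) + a * ((a + 1) * 4 ^ (a + 2)) * (t - 1) ^ 2 := by
  have hsub : ∀ x ∈ Set.uIcc 1 t, 1 / 4 ≤ x := fun x hx =>
    le_trans (le_min (by norm_num) ht) hx.1
  have h := Convex.norm_image_sub_le_of_norm_hasDerivWithin_le
    (f := fun t : ℝ => t ^ (-a) + a * (t - 1))
    (f' := fun t => -a * t ^ (-a - 1) + a) (C := a * ((a + 1) * 4 ^ (a + 2) * |t - 1|))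
    (s := Set.uIcc 1 t) (x := 1) (y := t) ?_ ?_ (convex_uIcc _ _) Set.left_mem_uIcc
    Set.right_mem_uIcc
  · simp only [sub_self, mul_zero, Real.one_rpow, add_zero, Real.norm_eq_abs] at h
    have := (abs_le.1 h).2
    have e : |t - 1| * |t - 1| = (t - 1) ^ 2 := by rw [← abs_mul, ← sq, abs_of_nonneg (sq_nonneg _)]
    have e2 : a * ((a + 1) * 4 ^ (a + 2) * |t - 1|) * |t - 1|
      = a * ((a + 1) * 4 ^ (a + 2)) * (t - 1) ^ 2 := by rw [← e]; ring
    linarith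
  · intro x hx
    have hx0 : 0 < x := lt_of_lt_of_le (by norm_num) (hsub x hx)
    have h1 := (Real.hasDerivAt_rpow_const (x := x) (p := -a) (Or.inl hx0.ne'))
    have h2 := ((hasDerivAt_id x).sub_const 1).const_mul a
    rw [mul_one] at h2
    exact (h1.add h2).hasDerivWithinAt
  · intro x hx
    have h1 := abs_rpow_neg_sub_one_le (b := a + 1) (by linarith) (hsub x hx)
    rw [show -a * x ^ (-a - 1) + a = -(a * (x ^ (-(a + 1)) - 1)) by
      rw [show -(a + 1) = -a - 1 by ring]; ring, norm_neg, norm_mul, Real.norm_of_nonneg ha]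
    refine mul_le_mul_of_nonneg_left ?_ ha
    refine h1.trans ?_
    rw [show a + 1 + 1 = a + 2 by ring]
    refine mul_le_mul_of_nonneg_left ?_ (by positivity)
    rw [abs_sub_comm x 1]
    exact (abs_sub_comm 1 x ▸ Set.abs_sub_left_of_mem_uIcc hx)

/-- The compactly supported test functions `(ψ^{1/2} - δ)₊²`, increasing to `ψ` as `δ → 0`. -/
def psiCutoff {N : ℕ} (γ δ : ℝ) (x : EuclideanSpace ℝ (Fin N)) : ℝ :=
  (max (psiWeight (γ / 2) x - δ) 0) ^ 2

lemma sq_psiWeight_half {N : ℕ} (γ : ℝ) (x : EuclideanSpace ℝ (Fin N)) :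
    psiWeight (γ / 2) x ^ 2 = psiWeight γ x := by
  rw [psiWeight, psiWeight, ← Real.rpow_natCast, ← Real.rpow_mul (by positivity)]
  congr 1; push_cast; ring

lemma psiCutoff_nonneg {N : ℕ} (γ δ : ℝ) (x : EuclideanSpace ℝ (Fin N)) : 0 ≤ psiCutoff γ δ x :=
  sq_nonneg _

lemma psiCutoff_le {N : ℕ} (γ : ℝ) {δ : ℝ} (hδ : 0 ≤ δ) (x : EuclideanSpace ℝ (Fin N)) :
    psiCutoff γ δ x ≤ psiWeight γ x := by
  rw [← sq_psiWeight_half, psiCutoff]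
  have := psiWeight_pos (γ / 2) x
  gcongr
  exact max_le (by linarith) this.le

lemma continuous_psiCutoff {N : ℕ} (γ δ : ℝ) :
    Continuous (psiCutoff γ δ : EuclideanSpace ℝ (Fin N) → ℝ) :=
  (((continuous_psiWeight _).sub continuous_const).max continuous_const).pow 2

lemma tendsto_psiCutoff {N : ℕ} (γ : ℝ) (x : EuclideanSpace ℝ (Fin N)) :
    Tendsto (fun δ => psiCutoff γ δ x) (𝓝[>] 0) (𝓝 (psiWeight γ x)) := by
  have : Continuous fun δ : ℝ => psiCutoff γ δ x := by unfold psiCutoff; fun_prop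
  have h := (this.tendsto 0).mono_left (nhdsWithin_le_nhds (s := Set.Ioi 0))
  simpa [psiCutoff, (psiWeight_pos (γ / 2) x).le, sq_psiWeight_half] using h

lemma exists_psiCutoff_eq_zero {N : ℕ} {γ : ℝ} (hγ : 0 < γ) {δ : ℝ} (hδ : 0 < δ) :
    ∃ R : ℝ, 0 ≤ R ∧ ∀ x : EuclideanSpace ℝ (Fin N), R < ‖x‖ → psiCutoff γ δ x = 0 := by
  have h : Tendsto (fun r : ℝ => (1 + r ^ 2) ^ (-(γ / 4))) atTop (𝓝 0) :=
    (tendsto_rpow_neg_atTop (by positivity)).comp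
      (tendsto_atTop_add_const_left _ _ (tendsto_pow_atTop two_ne_zero))
  obtain ⟨R, hR⟩ := eventually_atTop.1 (h.eventually (gt_mem_nhds hδ))
  refine ⟨max R 0, le_max_right _ _, fun x hx => ?_⟩
  have h1 := hR ‖x‖ (le_trans (le_max_left _ _) hx.le)
  have : psiWeight (γ / 2) x ≤ δ := by
    rw [psiWeight, show -(γ / 2) / 2 = -(γ / 4) by ring]; exact h1.le
  rw [psiCutoff, max_eq_right (by linarith)]; norm_num

/-- The symmetric second difference of the square root weight, and its first difference. -/
lemma psiWeight_differences {N : ℕ} {γ : ℝ} (hγ : 0 ≤ γ) :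
    ∃ M : ℝ, 0 ≤ M ∧ ∀ x z : EuclideanSpace ℝ (Fin N), ‖z‖ ≤ 1 →
      |psiWeight γ (x + z) - psiWeight γ x| ≤ M * psiWeight γ x * ‖z‖ ∧
      psiWeight γ (x + z) + psiWeight γ (x - z) - 2 * psiWeight γ x ≤
        M * psiWeight γ x * ‖z‖ ^ 2 := by
  set a := γ / 2 with ha
  have ha0 : 0 ≤ a := by positivity
  set C₁ := a * 4 ^ (a + 1)
  set C₂ := a * ((a + 1) * 4 ^ (a + 2))
  have hC1 : 0 ≤ C₁ := by positivity
  have hC2 : 0 ≤ C₂ := by positivity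
  -- Here `t = (1 + ‖x + z‖²) / (1 + ‖x‖²)`, which reduces both differences to one-variable
  -- estimates for `t^(-a)` near `1`.
  have main : ∀ x z : EuclideanSpace ℝ (Fin N), ‖z‖ ≤ 1 → ∃ t : ℝ, 1 / 4 ≤ t ∧
      |t - 1| ≤ 3 * ‖z‖ ∧ t = 1 + (2 * inner ℝ x z + ‖z‖ ^ 2) / (1 + ‖x‖ ^ 2) ∧
      psiWeight γ (x + z) = psiWeight γ x * t ^ (-a) := by
    intro x z hz
    have hq : 0 < 1 + ‖x‖ ^ 2 := by positivity
    have hz2 : ‖z‖ ^ 2 ≤ 1 := pow_le_one₀ (norm_nonneg _) hz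
    have hadd : 1 + ‖x + z‖ ^ 2 = (1 + ‖x‖ ^ 2) + (2 * inner ℝ x z + ‖z‖ ^ 2) := by
      rw [norm_add_sq_real]; ring
    have ht : 1 + (2 * inner ℝ x z + ‖z‖ ^ 2) / (1 + ‖x‖ ^ 2) =
        (1 + ‖x + z‖ ^ 2) / (1 + ‖x‖ ^ 2) := by rw [hadd]; field_simp
    refine ⟨_, ?_, ?_, rfl, ?_⟩
    · rw [ht, le_div_iff₀ hq]
      have h := norm_add_sq_le_two (x + z) (-z)
      rw [add_neg_cancel_right, norm_neg] at h
      nlinarith [sq_nonneg ‖x + z‖]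
    · rw [add_sub_cancel_left, abs_div, abs_of_pos hq, div_le_iff₀ hq]
      have h1 := abs_real_inner_le_norm x z
      have h2 : |2 * inner ℝ x z + ‖z‖ ^ 2| ≤ 2 * (‖x‖ * ‖z‖) + ‖z‖ ^ 2 := by
        refine (abs_add_le _ _).trans ?_
        rw [abs_mul, abs_of_pos (by norm_num : (0 : ℝ) < 2), abs_of_nonneg (sq_nonneg ‖z‖)]
        linarith
      refine h2.trans ?_
      nlinarith [norm_nonneg z, mul_nonneg (norm_nonneg z) (sq_nonneg (‖x‖ - 1)),
        mul_nonneg (norm_nonneg z) (sq_nonneg ‖x‖), mul_nonneg (norm_nonneg z) (sub_nonneg.2 hz)]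
    · have hneg : -γ / 2 = -a := by rw [ha]; ring
      rw [ht, psiWeight, psiWeight, hneg, Real.div_rpow (by positivity) hq.le]
      field_simp
  refine ⟨3 * C₁ + 18 * C₂, by positivity, fun x z hz => ?_⟩
  have hψ := psiWeight_pos γ x
  obtain ⟨t, ht, ht1, hteq, htψ⟩ := main x z hz
  obtain ⟨r, hr, hr1, hreq, hrψ⟩ := main x (-z) (by rwa [norm_neg])
  rw [norm_neg] at hr1 hreq
  rw [← sub_eq_add_neg] at hrψ
  constructor
  · rw [htψ, show psiWeight γ x * t ^ (-a) - psiWeight γ x = psiWeight γ x * (t ^ (-a) - 1) by ring,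
      abs_mul, abs_of_pos hψ]
    have h1 := abs_rpow_neg_sub_one_le ha0 ht
    have h2 : |t ^ (-a) - 1| ≤ (3 * C₁ + 18 * C₂) * ‖z‖ := by
      refine h1.trans ?_
      change C₁ * |t - 1| ≤ _
      nlinarith [norm_nonneg z, mul_nonneg hC2 (norm_nonneg z)]
    nlinarith
  · have h1 : t ^ (-a) ≤ 1 - a * (t - 1) + C₂ * (t - 1) ^ 2 := rpow_neg_le_quadratic ha0 ht
    have h2 : r ^ (-a) ≤ 1 - a * (r - 1) + C₂ * (r - 1) ^ 2 := rpow_neg_le_quadratic ha0 hr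
    -- The inner products cancel between `z` and `-z`. What remains of the first-order terms is
    -- nonnegative and enters with a minus sign, so it can be dropped.
    have h3 : 0 ≤ a * ((t - 1) + (r - 1)) := by
      refine mul_nonneg ha0 ?_
      rw [hteq, hreq, inner_neg_right]
      have : 1 + (2 * inner ℝ x z + ‖z‖ ^ 2) / (1 + ‖x‖ ^ 2) - 1 +
          (1 + (2 * -inner ℝ x z + ‖z‖ ^ 2) / (1 + ‖x‖ ^ 2) - 1) =
          2 * ‖z‖ ^ 2 / (1 + ‖x‖ ^ 2) := by ring
      rw [this]; positivity
    have h4 : (t - 1) ^ 2 ≤ 9 * ‖z‖ ^ 2 := by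
      rw [← sq_abs]; nlinarith [abs_nonneg (t - 1), norm_nonneg z]
    have h5 : (r - 1) ^ 2 ≤ 9 * ‖z‖ ^ 2 := by
      rw [← sq_abs]; nlinarith [abs_nonneg (r - 1), norm_nonneg z]
    have h6 : t ^ (-a) + r ^ (-a) - 2 ≤ (3 * C₁ + 18 * C₂) * ‖z‖ ^ 2 := by
      nlinarith [mul_nonneg hC1 (sq_nonneg ‖z‖), mul_le_mul_of_nonneg_left h4 hC2,
        mul_le_mul_of_nonneg_left h5 hC2]
    rw [htψ, hrψ]
    nlinarith

/-- The map `t ↦ (t₊)²` has a 2-Lipschitz derivative `2 t₊`, hence lies below its tangent parabola.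
This is why the cutoff is a squared positive part: `t₊` itself has a convex kink. -/
lemma sq_max_zero_le (a b : ℝ) :
    max b 0 ^ 2 ≤ max a 0 ^ 2 + 2 * max a 0 * (b - a) + (b - a) ^ 2 := by
  rcases le_total a 0 with ha | ha <;> rcases le_total b 0 with hb | hb <;>
    simp only [max_eq_left, max_eq_right, ha, hb] <;> nlinarith

/-- The test functions are semiconcave relative to `ψ`, uniformly in the cutoff parameter. -/
lemma psiCutoff_second_difference_le {N : ℕ} {γ : ℝ} (hγ : 0 ≤ γ) :
    ∃ M : ℝ, 0 ≤ M ∧ ∀ δ : ℝ, 0 ≤ δ → ∀ x z : EuclideanSpace ℝ (Fin N), ‖z‖ ≤ 1 →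
      psiCutoff γ δ (x + z) + psiCutoff γ δ (x - z) - 2 * psiCutoff γ δ x ≤
        M * psiWeight γ x * ‖z‖ ^ 2 := by
  obtain ⟨M, hM, h⟩ := psiWeight_differences (N := N) (γ := γ / 2) (by positivity)
  -- The term `2M` comes from the second difference of `ψ^{1/2}` multiplied by `2m ≤ 2G`; `2M²`
  -- comes from the two squared first differences.
  refine ⟨2 * M + 2 * M ^ 2, by positivity, fun δ hδ x z hz => ?_⟩
  obtain ⟨h1, h3⟩ := h x z hz
  have h2 := (h x (-z) (by rwa [norm_neg])).1
  rw [norm_neg, ← sub_eq_add_neg] at h2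
  have hG := psiWeight_pos (γ / 2) x
  have e1 := sq_max_zero_le (psiWeight (γ / 2) x - δ) (psiWeight (γ / 2) (x + z) - δ)
  have e2 := sq_max_zero_le (psiWeight (γ / 2) x - δ) (psiWeight (γ / 2) (x - z) - δ)
  rw [← sq_psiWeight_half]
  unfold psiCutoff
  set G := psiWeight (γ / 2) x
  set m := max (G - δ) 0 with hm
  have hm0 : 0 ≤ m := le_max_right _ _
  have hmG : m ≤ G := max_le (by linarith) hG.le
  have s1 : (psiWeight (γ / 2) (x + z) - G) ^ 2 ≤ (M * G * ‖z‖) ^ 2 := by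
    rw [← sq_abs]; gcongr
  have s2 : (psiWeight (γ / 2) (x - z) - G) ^ 2 ≤ (M * G * ‖z‖) ^ 2 := by
    rw [← sq_abs]; gcongr
  have s3 : m * (psiWeight (γ / 2) (x + z) + psiWeight (γ / 2) (x - z) - 2 * G) ≤
      G * (M * G * ‖z‖ ^ 2) := by
    have : 0 ≤ M * G * ‖z‖ ^ 2 := by positivity
    nlinarith
  rw [sub_sub_sub_cancel_right] at e1 e2
  nlinarith

end

/-! ### Finite symmetric jump measures: bounds and symmetry of their operators. -/

noncomputable section

/-- Finite symmetric jump measures with second moment at most `A` near the origin and with tail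
at most `B ψ_γ dz`. -/
structure IsJumpMeasure {N : ℕ} (γ A B : ℝ) (μ : Measure (EuclideanSpace ℝ (Fin N))) : Prop where
  finite : IsFiniteMeasure μ
  neg_invariant : μ.IsNegInvariant
  small : ∫ z in Metric.ball 0 1, ‖z‖ ^ 2 ∂μ ≤ A
  tail : μ.restrict (Metric.ball 0 1)ᶜ ≤
    volume.withDensity fun z => ENNReal.ofReal (B * psiWeight γ z)

/-- The bounded jump operator `f ↦ ∫ (f(x+z) - f(x)) dμ(z)`. -/
def jumpOp {N : ℕ} (μ : Measure (EuclideanSpace ℝ (Fin N)))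
    (f : EuclideanSpace ℝ (Fin N) → ℝ) (x : EuclideanSpace ℝ (Fin N)) : ℝ :=
  ∫ z, (f (x + z) - f x) ∂μ

variable {N : ℕ} {γ A B : ℝ} {μ : Measure (EuclideanSpace ℝ (Fin N))}

/-- Peetre's inequality moves the weight from `z` to `x + z` at a cost depending only on `x`;
translation invariance does the rest. -/
lemma integrable_shift_mul_psiWeight {w : EuclideanSpace ℝ (Fin N) → ℝ} (hγ : 0 ≤ γ)
    (hw : Continuous w) (hwi : Integrable fun x => w x * psiWeight γ x)
    (x : EuclideanSpace ℝ (Fin N)) :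
    Integrable (fun z => w (x + z) * psiWeight γ z) ∧
      ∫ z, |w (x + z)| * psiWeight γ z ≤
        (2 * (1 + ‖x‖ ^ 2)) ^ (γ / 2) * ∫ z, |w z| * psiWeight γ z := by
  have h1 : Integrable fun z => (2 * (1 + ‖x‖ ^ 2)) ^ (γ / 2) *
      (|w (x + z)| * psiWeight γ (x + z)) := by
    refine Integrable.const_mul ?_ _
    have h2 : Integrable fun z => |w z| * psiWeight γ z := by
      refine hwi.norm.congr (Eventually.of_forall fun z => ?_)
      simp [abs_of_pos (psiWeight_pos γ z)]
    exact h2.comp_add_left x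
  have hb : ∀ z, |w (x + z)| * psiWeight γ z ≤ (2 * (1 + ‖x‖ ^ 2)) ^ (γ / 2) *
      (|w (x + z)| * psiWeight γ (x + z)) := fun z => by
    have := mul_le_mul_of_nonneg_left (psiWeight_peetre hγ x z) (abs_nonneg (w (x + z)))
    linarith
  have h0 : Integrable (fun z => w (x + z) * psiWeight γ z) := by
    refine h1.mono' ((hw.comp (by fun_prop)).mul (continuous_psiWeight γ)).aestronglyMeasurable
      (Eventually.of_forall fun z => ?_)
    rw [norm_mul, Real.norm_of_nonneg (psiWeight_pos γ z).le]
    exact hb z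
  refine ⟨h0, ?_⟩
  calc ∫ z, |w (x + z)| * psiWeight γ z ≤ ∫ z, (2 * (1 + ‖x‖ ^ 2)) ^ (γ / 2) *
      (|w (x + z)| * psiWeight γ (x + z)) := by
        refine integral_mono ?_ h1 hb
        refine h0.norm.congr (Eventually.of_forall fun z => ?_)
        simp [abs_of_pos (psiWeight_pos γ z)]
    _ = _ := by
        rw [integral_const_mul, integral_add_left_eq_self (fun z => |w z| * psiWeight γ z)]

namespace IsJumpMeasure

/-- Comparison of the tail of a jump measure with the weight. -/
lemma tail_integral (h : IsJumpMeasure γ A B μ) (hB : 0 ≤ B) {f : EuclideanSpace ℝ (Fin N) → ℝ}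
    (hf : Integrable fun z => f z * psiWeight γ z) :
    IntegrableOn f (Metric.ball 0 1)ᶜ μ ∧
      ∫ z in (Metric.ball 0 1)ᶜ, |f z| ∂μ ≤ B * ∫ z, |f z| * psiWeight γ z := by
  have hm : Measurable fun z : EuclideanSpace ℝ (Fin N) =>
      ENNReal.ofReal (B * psiWeight γ z) :=
    ((continuous_psiWeight γ).measurable.const_mul B).ennreal_ofReal
  have hlt : ∀ᵐ z : EuclideanSpace ℝ (Fin N) ∂volume,
      ENNReal.ofReal (B * psiWeight γ z) < ⊤ := Eventually.of_forall fun z => ENNReal.ofReal_lt_top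
  have htr : ∀ z : EuclideanSpace ℝ (Fin N),
      (ENNReal.ofReal (B * psiWeight γ z)).toReal = B * psiWeight γ z := fun z =>
    ENNReal.toReal_ofReal (mul_nonneg hB (psiWeight_pos γ z).le)
  have hi : Integrable f (volume.withDensity fun z => ENNReal.ofReal (B * psiWeight γ z)) := by
    rw [integrable_withDensity_iff hm hlt]
    refine (hf.const_mul B).congr (Eventually.of_forall fun z => ?_)
    simp only [htr]; ring
  refine ⟨hi.mono_measure h.tail, ?_⟩
  refine (integral_mono_measure h.tail (Eventually.of_forall fun z => abs_nonneg _)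
    hi.norm).trans_eq ?_
  rw [integral_withDensity_eq_integral_toReal_smul hm hlt, ← integral_const_mul]
  refine integral_congr_ae (Eventually.of_forall fun z => ?_)
  simp only [htr, smul_eq_mul]; ring

lemma integrable_shift (h : IsJumpMeasure γ A B μ) (hγ : 0 ≤ γ) (hB : 0 ≤ B)
    {w : EuclideanSpace ℝ (Fin N) → ℝ} (hw : Continuous w)
    (hwi : Integrable fun x => w x * psiWeight γ x) (x : EuclideanSpace ℝ (Fin N)) :
    Integrable (fun z => w (x + z)) μ := by
  have := h.finite
  have h1 := (h.tail_integral hB (integrable_shift_mul_psiWeight hγ hw hwi x).1).1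
  have h2 : IntegrableOn (fun z => w (x + z)) (Metric.ball 0 1) μ :=
    (((hw.comp (by fun_prop : Continuous fun z => x + z)).continuousOn).integrableOn_compact
      (isCompact_closedBall 0 1)).mono_set Metric.ball_subset_closedBall
  rw [← integrableOn_univ, ← Set.union_compl_self (Metric.ball (0 : EuclideanSpace ℝ (Fin N)) 1)]
  exact h2.union h1

lemma setIntegral_ball_neg (h : IsJumpMeasure γ A B μ) (f : EuclideanSpace ℝ (Fin N) → ℝ) :
    ∫ z in Metric.ball 0 1, f (-z) ∂μ = ∫ z in Metric.ball 0 1, f z ∂μ := by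
  have := h.neg_invariant
  rw [← integral_indicator Metric.isOpen_ball.measurableSet,
    ← integral_indicator Metric.isOpen_ball.measurableSet, ← integral_neg_eq_self]
  refine integral_congr_ae (Eventually.of_forall fun z => ?_)
  simp [Set.indicator]

/-- Averaging over `z` and `-z` turns first differences into second differences, so short jumps are
controlled by the second moment alone and not by the total mass, which is not bounded uniformly. -/
lemma setIntegral_ball_sub_eq (h : IsJumpMeasure γ A B μ) {f : EuclideanSpace ℝ (Fin N) → ℝ}
    (hf : Continuous f) (x : EuclideanSpace ℝ (Fin N)) :
    2 * ∫ z in Metric.ball 0 1, (f (x + z) - f x) ∂μ =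
      ∫ z in Metric.ball 0 1, (f (x + z) + f (x - z) - 2 * f x) ∂μ ∧
    IntegrableOn (fun z => f (x + z) + f (x - z) - 2 * f x) (Metric.ball 0 1) μ ∧
    IntegrableOn (fun z => ‖z‖ ^ 2) (Metric.ball 0 1) μ := by
  have := h.finite
  have hint : ∀ {g : EuclideanSpace ℝ (Fin N) → ℝ}, Continuous g →
      IntegrableOn g (Metric.ball 0 1) μ := fun hg =>
    (hg.continuousOn.integrableOn_compact (isCompact_closedBall 0 1)).mono_set
      Metric.ball_subset_closedBall
  refine ⟨?_, hint (by fun_prop), hint (by fun_prop)⟩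
  have e := h.setIntegral_ball_neg fun z => f (x + z) - f x
  have h1 : ∀ z, f (x + z) + f (x - z) - 2 * f x = (f (x + z) - f x) + (f (x + -z) - f x) := by
    intro z; rw [← sub_eq_add_neg x z]; ring
  simp_rw [h1]
  rw [integral_add (hint (by fun_prop)) (hint (by fun_prop)), e]
  ring

/-- A jump operator applied to a function that is semiconcave relative to `ψ` is at most a multiple
of `ψ`, uniformly in the jump measure. -/
lemma jumpOp_le (h : IsJumpMeasure γ A B μ) (hγ : (N : ℝ) < γ) (hB : 0 ≤ B) {M : ℝ} (hM : 0 ≤ M)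
    {φ : EuclideanSpace ℝ (Fin N) → ℝ} (hφ : Continuous φ) (hφ0 : ∀ x, 0 ≤ φ x)
    (hφψ : ∀ x, φ x ≤ psiWeight γ x)
    (hM2 : ∀ x z : EuclideanSpace ℝ (Fin N), ‖z‖ ≤ 1 →
      φ (x + z) + φ (x - z) - 2 * φ x ≤ M * psiWeight γ x * ‖z‖ ^ 2)
    (x : EuclideanSpace ℝ (Fin N)) :
    jumpOp μ φ x ≤ (M * A / 2 + B * (4 ^ (γ / 2) *
      (2 * ∫ z : EuclideanSpace ℝ (Fin N), psiWeight γ z))) * psiWeight γ x := by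
  have hfin := h.finite
  have hγ0 : 0 ≤ γ := le_trans (by positivity) hγ.le
  have hψi := integrable_psiWeight hγ
  have hψx := psiWeight_pos γ x
  have hφψi : Integrable fun z => φ z * psiWeight γ z := by
    refine hψi.mono' (hφ.mul (continuous_psiWeight γ)).aestronglyMeasurable
      (Eventually.of_forall fun z => ?_)
    rw [Real.norm_of_nonneg (mul_nonneg (hφ0 z) (psiWeight_pos γ z).le)]
    have := (hφψ z).trans (psiWeight_le_one hγ0 z)
    nlinarith [psiWeight_pos γ z, hφ0 z]
  have hsh := h.integrable_shift hγ0 hB hφ hφψi x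
  have hint : Integrable (fun z => φ (x + z) - φ x) μ := hsh.sub (integrable_const _)
  obtain ⟨e1, i1, i2⟩ := h.setIntegral_ball_sub_eq hφ x
  have hball : ∫ z in Metric.ball 0 1, (φ (x + z) - φ x) ∂μ ≤ M * A / 2 * psiWeight γ x := by
    have : ∫ z in Metric.ball 0 1, (φ (x + z) + φ (x - z) - 2 * φ x) ∂μ ≤
        ∫ z in Metric.ball 0 1, M * psiWeight γ x * ‖z‖ ^ 2 ∂μ :=
      setIntegral_mono_on i1 (i2.const_mul _) Metric.isOpen_ball.measurableSet fun z hz =>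
        hM2 x z (by simpa using (Metric.mem_ball.1 hz).le)
    rw [integral_const_mul] at this
    have h3 := mul_le_mul_of_nonneg_left h.small (mul_nonneg hM hψx.le)
    linarith
  have hψsh : Integrable fun z => psiWeight γ (x + z) := hψi.comp_add_left x
  have hcompl : ∫ z in (Metric.ball 0 1)ᶜ, (φ (x + z) - φ x) ∂μ ≤
      B * (4 ^ (γ / 2) * (2 * ∫ z : EuclideanSpace ℝ (Fin N), psiWeight γ z)) *
        psiWeight γ x := by
    obtain ⟨j1, j2⟩ := h.tail_integral hB (integrable_shift_mul_psiWeight hγ0 hφ hφψi x).1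
    -- Only an upper bound is needed: `-φ(x) ≤ 0` is discarded, and the gain from `φ(x + z)` is
    -- estimated through `psiWeight_mul_le`.
    have j3 : ∫ z in (Metric.ball 0 1)ᶜ, (φ (x + z) - φ x) ∂μ ≤
        ∫ z in (Metric.ball 0 1)ᶜ, |φ (x + z)| ∂μ :=
      integral_mono hint.integrableOn j1.norm fun z =>
        (sub_le_self _ (hφ0 x)).trans (le_abs_self _)
    refine j3.trans (j2.trans ?_)
    rw [mul_assoc B]
    refine mul_le_mul_of_nonneg_left ?_ hB
    calc ∫ z, |φ (x + z)| * psiWeight γ z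
        ≤ ∫ z, 4 ^ (γ / 2) * psiWeight γ x * (psiWeight γ (x + z) + psiWeight γ z) := by
          refine integral_mono_of_nonneg (Eventually.of_forall fun z => by
            have := psiWeight_pos γ z; positivity) ((hψsh.add hψi).const_mul _)
            (Eventually.of_forall fun z => ?_)
          refine le_trans ?_ (psiWeight_mul_le hγ0 x z)
          simp only [abs_of_nonneg (hφ0 _)]
          exact mul_le_mul_of_nonneg_right (hφψ _) (psiWeight_pos γ z).le
      _ = _ := by
          rw [integral_const_mul, integral_add hψsh hψi, integral_add_left_eq_self (psiWeight γ)]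
          ring
  rw [jumpOp, ← integral_add_compl Metric.isOpen_ball.measurableSet hint, add_mul]
  exact add_le_add hball hcompl

/-- Bound of a jump operator by local semi-norms, uniform in the jump measure. -/
lemma abs_jumpOp_le (h : IsJumpMeasure γ A B μ) (hγ : (N : ℝ) < γ) (hB : 0 ≤ B) {M : ℝ}
    (hM : 0 ≤ M) {u : EuclideanSpace ℝ (Fin N) → ℝ} (hu : Continuous u)
    (hui : Integrable fun x => u x * psiWeight γ x) (x : EuclideanSpace ℝ (Fin N))
    (hM2 : ∀ z : EuclideanSpace ℝ (Fin N), ‖z‖ ≤ 1 →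
      |u (x + z) + u (x - z) - 2 * u x| ≤ M * ‖z‖ ^ 2) :
    |jumpOp μ u x| ≤ M * A / 2 + B * ((2 * (1 + ‖x‖ ^ 2)) ^ (γ / 2) *
      (∫ z, |u z| * psiWeight γ z) +
      |u x| * ∫ z : EuclideanSpace ℝ (Fin N), psiWeight γ z) := by
  have hfin := h.finite
  have hγ0 : 0 ≤ γ := le_trans (by positivity) hγ.le
  have hψi := integrable_psiWeight hγ
  have hsh := h.integrable_shift hγ0 hB hu hui x
  have hint : Integrable (fun z => u (x + z) - u x) μ := hsh.sub (integrable_const _)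
  obtain ⟨e1, i1, i2⟩ := h.setIntegral_ball_sub_eq hu x
  have hball : |∫ z in Metric.ball 0 1, (u (x + z) - u x) ∂μ| ≤ M * A / 2 := by
    have h1 : |∫ z in Metric.ball 0 1, (u (x + z) + u (x - z) - 2 * u x) ∂μ| ≤
        ∫ z in Metric.ball 0 1, M * ‖z‖ ^ 2 ∂μ := by
      refine (abs_integral_le_integral_abs).trans ?_
      exact setIntegral_mono_on i1.abs (i2.const_mul _) Metric.isOpen_ball.measurableSet
        fun z hz => hM2 z (by simpa using (Metric.mem_ball.1 hz).le)
    rw [integral_const_mul, ← e1, abs_mul, abs_of_pos (by norm_num : (0 : ℝ) < 2)] at h1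
    have h3 := mul_le_mul_of_nonneg_left h.small hM
    linarith
  obtain ⟨s1, s2⟩ := integrable_shift_mul_psiWeight hγ0 hu hui x
  have hcompl : |∫ z in (Metric.ball 0 1)ᶜ, (u (x + z) - u x) ∂μ| ≤
      B * ((2 * (1 + ‖x‖ ^ 2)) ^ (γ / 2) * (∫ z, |u z| * psiWeight γ z) +
      |u x| * ∫ z : EuclideanSpace ℝ (Fin N), psiWeight γ z) := by
    obtain ⟨j1, j2⟩ := h.tail_integral hB s1
    obtain ⟨k1, k2⟩ := h.tail_integral hB (hψi.const_mul (u x))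
    rw [integral_const_mul] at k2
    rw [integral_sub j1 k1, mul_add]
    refine (abs_sub _ _).trans (add_le_add ?_ ?_)
    · exact abs_integral_le_integral_abs.trans (j2.trans (mul_le_mul_of_nonneg_left s2 hB))
    · exact abs_integral_le_integral_abs.trans k2
  rw [jumpOp, ← integral_add_compl Metric.isOpen_ball.measurableSet hint]
  exact (abs_add_le _ _).trans (add_le_add hball hcompl)

lemma stronglyMeasurable_jumpOp (h : IsJumpMeasure γ A B μ) {f : EuclideanSpace ℝ (Fin N) → ℝ}
    (hf : Continuous f) : StronglyMeasurable (jumpOp μ f) := by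
  have := h.finite
  have hc : Continuous fun p : EuclideanSpace ℝ (Fin N) × EuclideanSpace ℝ (Fin N) =>
    f (p.1 + p.2) - f p.1 := by fun_prop
  exact hc.stronglyMeasurable.integral_prod_right'

/-- Jump operators are symmetric. -/
lemma integral_mul_jumpOp (h : IsJumpMeasure γ A B μ) (hγ : (N : ℝ) < γ) (hB : 0 ≤ B)
    {φ w : EuclideanSpace ℝ (Fin N) → ℝ} (hφ : Continuous φ) (hφ0 : ∀ x, 0 ≤ φ x)
    (hφψ : ∀ x, φ x ≤ psiWeight γ x) (hw : Continuous w)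
    (hwi : Integrable fun x => w x * psiWeight γ x) :
    Integrable (fun x => φ x * jumpOp μ w x) ∧ Integrable (fun x => w x * jumpOp μ φ x) ∧
      ∫ x, φ x * jumpOp μ w x = ∫ x, w x * jumpOp μ φ x := by
  have hfin := h.finite
  have hneg := h.neg_invariant
  have hγ0 : 0 ≤ γ := le_trans (by positivity) hγ.le
  have hψi := integrable_psiWeight hγ
  have hφψi : Integrable fun z => φ z * psiWeight γ z := by
    refine hψi.mono' (hφ.mul (continuous_psiWeight γ)).aestronglyMeasurable
      (Eventually.of_forall fun z => ?_)
    rw [Real.norm_of_nonneg (mul_nonneg (hφ0 z) (psiWeight_pos γ z).le)]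
    have := (hφψ z).trans (psiWeight_le_one hγ0 z)
    nlinarith [psiWeight_pos γ z, hφ0 z]
  have hwφ : Integrable fun x => w x * φ x := by
    refine hwi.mono (hw.mul hφ).aestronglyMeasurable (Eventually.of_forall fun x => ?_)
    rw [norm_mul, norm_mul, Real.norm_of_nonneg (hφ0 x), Real.norm_of_nonneg (psiWeight_pos γ x).le]
    gcongr
    exact hφψ x
  have hφs := h.integrable_shift hγ0 hB hφ hφψi
  have hws := h.integrable_shift hγ0 hB hw hwi
  -- the integral of the shifted test function is controlled by the weight
  obtain ⟨D, hD⟩ : ∃ D : ℝ, ∀ x, ∫ z, φ (x + z) ∂μ ≤ D * psiWeight γ x := by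
    refine ⟨4 ^ (γ / 2) * μ.real Set.univ + B * (4 ^ (γ / 2) *
      (2 * ∫ z : EuclideanSpace ℝ (Fin N), psiWeight γ z)), fun x => ?_⟩
    have hψsh : Integrable fun z => psiWeight γ (x + z) := hψi.comp_add_left x
    obtain ⟨j1, j2⟩ := h.tail_integral hB (integrable_shift_mul_psiWeight hγ0 hφ hφψi x).1
    rw [← integral_add_compl Metric.isOpen_ball.measurableSet (hφs x), add_mul]
    refine add_le_add ?_ ?_
    · calc ∫ z in Metric.ball 0 1, φ (x + z) ∂μ
          ≤ ∫ z in Metric.ball 0 1, 4 ^ (γ / 2) * psiWeight γ x ∂μ :=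
            setIntegral_mono_on (hφs x).integrableOn (integrable_const _).integrableOn
              Metric.isOpen_ball.measurableSet fun z hz => (hφψ _).trans
                (psiWeight_add_le hγ0 x (by simpa using (Metric.mem_ball.1 hz).le))
        _ ≤ ∫ z, 4 ^ (γ / 2) * psiWeight γ x ∂μ :=
            setIntegral_le_integral (integrable_const _) (Eventually.of_forall fun z => by
              have := psiWeight_pos γ x; positivity)
        _ = _ := by rw [integral_const, smul_eq_mul]; ring
    · simp only [abs_of_nonneg (hφ0 _)] at j2
      rw [mul_assoc B]
      refine j2.trans (mul_le_mul_of_nonneg_left ?_ hB)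
      calc ∫ z, φ (x + z) * psiWeight γ z
          ≤ ∫ z, 4 ^ (γ / 2) * psiWeight γ x * (psiWeight γ (x + z) + psiWeight γ z) := by
            refine integral_mono_of_nonneg (Eventually.of_forall fun z =>
              mul_nonneg (hφ0 _) (psiWeight_pos γ z).le) ((hψsh.add hψi).const_mul _)
              (Eventually.of_forall fun z => ?_)
            exact le_trans (mul_le_mul_of_nonneg_right (hφψ _) (psiWeight_pos γ z).le)
              (psiWeight_mul_le hγ0 x z)
        _ = _ := by
            rw [integral_const_mul, integral_add hψsh hψi,
              integral_add_left_eq_self (psiWeight γ)]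
            ring
  have hG : Integrable (fun p : EuclideanSpace ℝ (Fin N) × EuclideanSpace ℝ (Fin N) =>
      w p.1 * φ (p.1 + p.2)) (volume.prod μ) := by
    have hc : Continuous fun p : EuclideanSpace ℝ (Fin N) × EuclideanSpace ℝ (Fin N) =>
      w p.1 * φ (p.1 + p.2) := by fun_prop
    rw [integrable_prod_iff hc.aestronglyMeasurable]
    refine ⟨Eventually.of_forall fun x => (hφs x).const_mul (w x), ?_⟩
    refine (hwi.const_mul D).mono
      (hc.norm.stronglyMeasurable.integral_prod_right').aestronglyMeasurable
      (Eventually.of_forall fun x => ?_)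
    have e : ∫ z, ‖w x * φ (x + z)‖ ∂μ = |w x| * ∫ z, φ (x + z) ∂μ := by
      rw [← integral_const_mul]
      refine integral_congr_ae (Eventually.of_forall fun z => ?_)
      simp [abs_of_nonneg (hφ0 _)]
    rw [e, norm_mul, norm_mul, norm_mul, Real.norm_of_nonneg (psiWeight_pos γ x).le,
      Real.norm_of_nonneg (integral_nonneg fun z => hφ0 _), Real.norm_eq_abs |w x|, abs_abs,
      Real.norm_eq_abs (w x)]
    calc |w x| * ∫ z, φ (x + z) ∂μ ≤ |w x| * (D * psiWeight γ x) := by gcongr; exact hD x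
      _ ≤ |w x| * (‖D‖ * psiWeight γ x) := by
          have := psiWeight_pos γ x
          gcongr
          exact Real.le_norm_self D
      _ = _ := by ring
  -- Reversing a jump, `(z, x) ↦ (-z, x + z)`, preserves `μ ⊗ dx`: `μ` is symmetric and Lebesgue
  -- measure is translation invariant. It interchanges the two products in the symmetry identity.
  have hT : MeasurePreserving
      (fun p : EuclideanSpace ℝ (Fin N) × EuclideanSpace ℝ (Fin N) => (-p.1, p.2 + p.1))
      (μ.prod volume) (μ.prod volume) := by
    refine MeasurePreserving.skew_product (f := fun z => -z) (g := fun z x => x + z)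
      (Measure.measurePreserving_neg μ) ?_ (Eventually.of_forall fun z => ?_)
    · exact (continuous_snd.add continuous_fst).measurable
    · exact map_add_right_eq_self volume z
  have hG' := hG.swap
  have hFc : Continuous fun p : EuclideanSpace ℝ (Fin N) × EuclideanSpace ℝ (Fin N) =>
      w (p.2 + p.1) * φ p.2 := by fun_prop
  have hcomp : (fun p : EuclideanSpace ℝ (Fin N) × EuclideanSpace ℝ (Fin N) =>
      w (p.2 + p.1) * φ p.2) ∘ (fun p => (-p.1, p.2 + p.1)) =
      (fun p : EuclideanSpace ℝ (Fin N) × EuclideanSpace ℝ (Fin N) =>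
      w p.1 * φ (p.1 + p.2)) ∘ Prod.swap := by
    funext p; simp
  have hF' : Integrable (fun p : EuclideanSpace ℝ (Fin N) × EuclideanSpace ℝ (Fin N) =>
      w (p.2 + p.1) * φ p.2) (μ.prod volume) := by
    rw [← hT.integrable_comp hFc.aestronglyMeasurable, hcomp]
    exact hG'
  have hF := hF'.swap
  have hFG : ∫ p, w (p.1 + p.2) * φ p.1 ∂(volume.prod μ) =
      ∫ p, w p.1 * φ (p.1 + p.2) ∂(volume.prod μ) :=
    calc ∫ p, w (p.1 + p.2) * φ p.1 ∂(volume.prod μ)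
        = ∫ p, w (p.2 + p.1) * φ p.2 ∂(μ.prod volume) :=
          integral_prod_swap (fun p => w (p.2 + p.1) * φ p.2)
      _ = ∫ p, w (p.2 + p.1) * φ p.2 ∂((μ.prod volume).map fun p => (-p.1, p.2 + p.1)) := by
          rw [hT.map_eq]
      _ = ∫ p, w p.swap.1 * φ (p.swap.1 + p.swap.2) ∂(μ.prod volume) := by
          rw [integral_map hT.measurable.aemeasurable hFc.aestronglyMeasurable]
          exact integral_congr_ae (Eventually.of_forall fun p => congrFun hcomp p)
      _ = _ := integral_prod_swap (fun p => w p.1 * φ (p.1 + p.2))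
  have hFi : Integrable fun x => ∫ z, w (x + z) * φ x ∂μ := hF.integral_prod_left
  have hGi : Integrable fun x => ∫ z, w x * φ (x + z) ∂μ := hG.integral_prod_left
  -- Since `μ` is finite, the shift part can be separated from the mass part, and the latter is the
  -- same on both sides.
  have m : ∀ x, φ x * jumpOp μ w x =
      (∫ z, w (x + z) * φ x ∂μ) - μ.real Set.univ * (w x * φ x) := fun x => by
    rw [jumpOp, integral_sub (hws x) (integrable_const _), integral_mul_const, integral_const,
      smul_eq_mul]
    ring
  have m' : ∀ x, w x * jumpOp μ φ x =
      (∫ z, w x * φ (x + z) ∂μ) - μ.real Set.univ * (w x * φ x) := fun x => by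
    rw [jumpOp, integral_sub (hφs x) (integrable_const _), integral_const_mul, integral_const,
      smul_eq_mul]
    ring
  simp_rw [m, m']
  refine ⟨hFi.sub (hwφ.const_mul _), hGi.sub (hwφ.const_mul _), ?_⟩
  rw [integral_sub hFi (hwφ.const_mul _), integral_sub hGi (hwφ.const_mul _)]
  congr 1
  exact (integral_prod _ hF).symm.trans (hFG.trans (integral_prod _ hG))

end IsJumpMeasure

end

/-! ### Second differences of `C²` functions and convexity of `|t|^p`. -/

noncomputable section

/-- Mean value form of the symmetric second difference of a `C²` function. -/
lemma exists_second_difference_eq {E : Type*} [NormedAddCommGroup E] [NormedSpace ℝ E]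
    {u : E → ℝ} (hu : ContDiff ℝ 2 u) (x z : E) :
    ∃ ξ ∈ Set.Icc (0 : ℝ) 1, u (x + z) + u (x - z) - 2 * u x =
      (fderiv ℝ (fderiv ℝ u) (x + ξ • z) z z + fderiv ℝ (fderiv ℝ u) (x - ξ • z) z z) / 2 := by
  have hd : Differentiable ℝ u := hu.differentiable two_ne_zero
  have hd2 : Differentiable ℝ (fderiv ℝ u) :=
    (hu.fderiv_right (m := 1) (by norm_num)).differentiable one_ne_zero
  have l1 : ∀ t : ℝ, HasDerivAt (fun t : ℝ => x + t • z) z t := fun t => by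
    simpa using ((hasDerivAt_id t).smul_const z).const_add x
  have l2 : ∀ t : ℝ, HasDerivAt (fun t : ℝ => x - t • z) (-z) t := fun t => by
    simpa using ((hasDerivAt_id t).smul_const z).const_sub x
  have h1 : ∀ t : ℝ, HasDerivAt (fun t : ℝ => u (x + t • z) + u (x - t • z))
      (fderiv ℝ u (x + t • z) z - fderiv ℝ u (x - t • z) z) t := fun t => by
    have := ((hd (x + t • z)).hasFDerivAt.comp_hasDerivAt t (l1 t)).add
      ((hd (x - t • z)).hasFDerivAt.comp_hasDerivAt t (l2 t))
    rw [map_neg, ← sub_eq_add_neg] at this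
    exact this
  have h2 : ∀ t : ℝ, HasDerivAt (fun t : ℝ => fderiv ℝ u (x + t • z) z - fderiv ℝ u (x - t • z) z)
      (fderiv ℝ (fderiv ℝ u) (x + t • z) z z + fderiv ℝ (fderiv ℝ u) (x - t • z) z z) t := by
    intro t
    have b1 : HasDerivAt (fun t : ℝ => fderiv ℝ u (x + t • z))
      (fderiv ℝ (fderiv ℝ u) (x + t • z) z) t :=
      (hd2 (x + t • z)).hasFDerivAt.comp_hasDerivAt t (l1 t)
    have b2 : HasDerivAt (fun t : ℝ => fderiv ℝ u (x - t • z))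
      (fderiv ℝ (fderiv ℝ u) (x - t • z) (-z)) t :=
      (hd2 (x - t • z)).hasFDerivAt.comp_hasDerivAt t (l2 t)
    have a1 : HasDerivAt (fun t : ℝ => fderiv ℝ u (x + t • z) z)
      (fderiv ℝ (fderiv ℝ u) (x + t • z) z z) t := by
      simpa using b1.clm_apply (hasDerivAt_const t z)
    have a2 : HasDerivAt (fun t : ℝ => fderiv ℝ u (x - t • z) z)
      (-fderiv ℝ (fderiv ℝ u) (x - t • z) z z) t := by
      simpa using b2.clm_apply (hasDerivAt_const t z)
    have a3 := a1.sub a2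
    rw [sub_neg_eq_add] at a3
    exact a3
  -- Cauchy's mean value theorem against `t²`, then the ordinary one for the first derivative, which
  -- vanishes at `t = 0` by symmetry.
  obtain ⟨c, hc, e1⟩ := exists_ratio_hasDerivAt_eq_ratio_slope _ _ (zero_lt_one (α := ℝ))
    (fun t _ => (h1 t).continuousAt.continuousWithinAt) (fun t _ => h1 t) (fun t : ℝ => t ^ 2)
    (fun t => 2 * t) (by fun_prop) (fun t _ => by simpa using hasDerivAt_pow 2 t)
  obtain ⟨ξ, hξ, e2⟩ := exists_hasDerivAt_eq_slope _ _ hc.1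
    (fun t _ => (h2 t).continuousAt.continuousWithinAt) (fun t _ => h2 t)
  refine ⟨ξ, ⟨hξ.1.le, (hξ.2.trans hc.2).le⟩, ?_⟩
  rw [e2]
  have hc0 := hc.1.ne'
  simp only [one_pow, one_smul, zero_smul, add_zero, sub_zero, sub_self, ne_eq, OfNat.ofNat_ne_zero,
    not_false_eq_true, zero_pow, one_mul] at e1 ⊢
  rw [e1]
  field_simp
  ring

lemma exists_second_difference_le {E : Type*} [NormedAddCommGroup E] [NormedSpace ℝ E]
    [ProperSpace E] {u : E → ℝ}
    (hu : ContDiff ℝ 2 u) (R : ℝ) :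
    ∃ M : ℝ, 0 ≤ M ∧ ∀ x z : E, ‖x‖ ≤ R → ‖z‖ ≤ 1 →
      |u (x + z) + u (x - z) - 2 * u x| ≤ M * ‖z‖ ^ 2 := by
  have hc : Continuous (fderiv ℝ (fderiv ℝ u)) :=
    (hu.fderiv_right (m := 1) (by norm_num)).continuous_fderiv one_ne_zero
  have hn : Continuous fun y => ‖fderiv ℝ (fderiv ℝ u) y‖ :=
    (continuous_norm (E := E →L[ℝ] E →L[ℝ] ℝ)).comp hc
  obtain ⟨M, hM⟩ := (isCompact_closedBall (0 : E)
    (R + 1)).exists_bound_of_continuousOn hn.continuousOn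
  refine ⟨max M 0, le_max_right _ _, fun x z hx hz => ?_⟩
  obtain ⟨ξ, ⟨h0, h1⟩, e⟩ := exists_second_difference_eq hu x z
  have hξ : ‖ξ • z‖ ≤ 1 := by
    rw [norm_smul, Real.norm_of_nonneg h0]; exact mul_le_one₀ h1 (norm_nonneg _) hz
  have key : ∀ y : E, ‖y‖ ≤ R + 1 →
      |fderiv ℝ (fderiv ℝ u) y z z| ≤ max M 0 * ‖z‖ ^ 2 := fun y hy => by
    have h2 := (fderiv ℝ (fderiv ℝ u) y).le_opNorm₂ z z
    have h3 := (Real.le_norm_self _).trans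
      ((hM y (by simpa using hy)).trans (le_max_left M 0))
    rw [Real.norm_eq_abs] at h2
    calc _ ≤ _ := h2
      _ ≤ max M 0 * ‖z‖ * ‖z‖ := by gcongr
      _ = _ := by ring
  have k1 := key (x + ξ • z) ((norm_add_le _ _).trans (by linarith))
  have k2 := key (x - ξ • z) ((norm_sub_le _ _).trans (by linarith))
  rw [e, abs_div, abs_of_pos (by norm_num : (0 : ℝ) < 2)]
  have := abs_add_le (fderiv ℝ (fderiv ℝ u) (x + ξ • z) z z)
    (fderiv ℝ (fderiv ℝ u) (x - ξ • z) z z)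
  linarith

lemma tendsto_second_difference {E : Type*} [NormedAddCommGroup E] [NormedSpace ℝ E]
    {u : E → ℝ} (hu : ContDiff ℝ 2 u) (x e : E) :
    Tendsto (fun ε : ℝ => (ε ^ 2)⁻¹ * (u (x + ε • e) + u (x - ε • e) - 2 * u x)) (𝓝[>] 0)
      (𝓝 (fderiv ℝ (fderiv ℝ u) x e e)) := by
  have hc : Continuous (fderiv ℝ (fderiv ℝ u)) :=
    (hu.fderiv_right (m := 1) (by norm_num)).continuous_fderiv one_ne_zero
  choose ξ hξ he using fun ε : ℝ => exists_second_difference_eq hu x (ε • e)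
  have hid : Tendsto (fun ε : ℝ => ε) (𝓝[>] 0) (𝓝 0) := tendsto_id.mono_left nhdsWithin_le_nhds
  have h0 : Tendsto (fun ε : ℝ => ξ ε * ε) (𝓝[>] 0) (𝓝 0) := by
    refine squeeze_zero_norm (a := fun ε : ℝ => |ε|) (fun ε => ?_) (by simpa using hid.abs)
    rw [norm_mul, Real.norm_of_nonneg (hξ ε).1]
    exact mul_le_of_le_one_left (abs_nonneg _) (hξ ε).2
  have hG : Continuous fun t : ℝ => (fderiv ℝ (fderiv ℝ u) (x + t • e) e e +
      fderiv ℝ (fderiv ℝ u) (x - t • e) e e) / 2 := by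
    have c1 : Continuous fun t : ℝ => fderiv ℝ (fderiv ℝ u) (x + t • e) := hc.comp (by fun_prop)
    have c2 : Continuous fun t : ℝ => fderiv ℝ (fderiv ℝ u) (x - t • e) := hc.comp (by fun_prop)
    exact (((c1.clm_apply continuous_const).clm_apply continuous_const).add
      ((c2.clm_apply continuous_const).clm_apply continuous_const)).div_const 2
  have h1 := (hG.tendsto 0).comp h0
  simp only [zero_smul, add_zero, sub_zero, add_self_div_two] at h1
  refine h1.congr' ?_
  filter_upwards [self_mem_nhdsWithin] with ε hε
  have hε0 : ε ≠ 0 := (Set.mem_Ioi.1 hε).ne'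
  rw [he ε]
  simp only [Function.comp, smul_smul, map_smul, smul_apply, smul_eq_mul]
  field_simp

/-- A subgradient of `t ↦ |t|^p`. -/
def absRpowSubgradient (p a : ℝ) : ℝ := p * |a| ^ (p - 1) * Real.sign a

lemma absRpowSubgradient_mul_self {p : ℝ} (hp : 1 ≤ p) (a : ℝ) :
    absRpowSubgradient p a * a = p * |a| ^ p := by
  rcases eq_or_ne a 0 with rfl | ha
  · simp [absRpowSubgradient, Real.zero_rpow (by linarith : p ≠ 0)]
  · have h1 : Real.sign a * a = |a| := by
      rcases lt_or_gt_of_ne ha with h | h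
      · rw [Real.sign_of_neg h, abs_of_neg h]; ring
      · rw [Real.sign_of_pos h, abs_of_pos h]; ring
    have h2 : |a| ^ p = |a| ^ (p - 1) * |a| := by
      rw [← Real.rpow_add_one (abs_ne_zero.2 ha)]; congr 1; ring
    rw [absRpowSubgradient, mul_assoc, h1, h2]; ring

/-- After division by `|a|^p` this is Bernoulli's inequality at `|b| / |a| - 1`, together with
`sign(a) b ≤ |b|`. At `a = 0` the convention `Real.sign 0 = 0` makes the left side vanish, including
when `p = 1`. -/
lemma absRpowSubgradient_le {p : ℝ} (hp : 1 ≤ p) (a b : ℝ) :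
    absRpowSubgradient p a * (b - a) ≤ |b| ^ p - |a| ^ p := by
  rw [mul_sub, absRpowSubgradient_mul_self hp]
  rcases eq_or_ne a 0 with rfl | ha
  · simp [absRpowSubgradient, Real.zero_rpow (by linarith : p ≠ 0)]
    positivity
  · have ha' : 0 < |a| := abs_pos.2 ha
    have hq : 0 ≤ |a| ^ (p - 1) := by positivity
    have h2 : |a| ^ p = |a| ^ (p - 1) * |a| := by
      rw [← Real.rpow_add_one ha'.ne']; congr 1; ring
    have h3 : Real.sign a * b ≤ |b| := by
      rcases lt_or_gt_of_ne ha with h | h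
      · rw [Real.sign_of_neg h]; linarith [neg_le_abs b]
      · rw [Real.sign_of_pos h]; linarith [le_abs_self b]
    have h4 := one_add_mul_self_le_rpow_one_add (s := |b| / |a| - 1)
      (by have : 0 ≤ |b| / |a| := by positivity
          linarith) hp
    rw [add_sub_cancel, Real.div_rpow (abs_nonneg _) (abs_nonneg _),
      le_div_iff₀ (by positivity)] at h4
    have h5 : (1 + p * (|b| / |a| - 1)) * |a| ^ p =
        |a| ^ p + p * |a| ^ (p - 1) * |b| - p * |a| ^ p := by
      rw [h2]; field_simp; ring
    have h6 : absRpowSubgradient p a * b ≤ p * |a| ^ (p - 1) * |b| := by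
      rw [absRpowSubgradient, mul_assoc]; gcongr
    linarith

lemma abs_absRpowSubgradient_le {p D a : ℝ} (hp : 1 ≤ p) (ha : |a| ≤ D) :
    |absRpowSubgradient p a| ≤ p * D ^ (p - 1) := by
  have hs : |Real.sign a| ≤ 1 := by
    rcases Real.sign_apply_eq a with h | h | h <;> simp [h]
  rw [absRpowSubgradient, abs_mul, abs_mul, abs_of_nonneg (by linarith : 0 ≤ p),
    abs_of_nonneg (by positivity : 0 ≤ |a| ^ (p - 1))]
  calc p * |a| ^ (p - 1) * |Real.sign a| ≤ p * |a| ^ (p - 1) * 1 := by gcongr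
    _ ≤ p * D ^ (p - 1) := by
      rw [mul_one]
      gcongr

lemma measurable_absRpowSubgradient (p : ℝ) : Measurable (absRpowSubgradient p) := by
  have hs : Measurable Real.sign := by
    unfold Real.sign
    exact Measurable.ite measurableSet_Iio measurable_const
      (Measurable.ite measurableSet_Ioi measurable_const measurable_const)
  exact (measurable_const.mul ((measurable_id.abs).pow_const _)).mul hs

end

/-! ### Approximation of the mixed operator by jump operators. -/

noncomputable section

/-- The kernel `C_{N,s} |z|^{-N-2s}` truncated at distance `ε`. -/
def truncatedKernel (N : ℕ) (s ε : ℝ) : EuclideanSpace ℝ (Fin N) → ℝ :=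
  Set.indicator {z | ε ≤ ‖z‖} fun z => fracLapConst N s / ‖z‖ ^ ((N : ℝ) + 2 * s)

/-- The jump measure whose operator approximates `Δ - (-Δ)^s` as `ε → 0⁺`. -/
def mixedJumpMeasure (N : ℕ) (s ε : ℝ) : Measure (EuclideanSpace ℝ (Fin N)) :=
  (volume.withDensity fun z => ENNReal.ofReal (truncatedKernel N s ε z)) +
    ENNReal.ofReal (ε ^ 2)⁻¹ • ∑ i, (Measure.dirac (ε • EuclideanSpace.basisFun (Fin N) ℝ i) +
      Measure.dirac (-(ε • EuclideanSpace.basisFun (Fin N) ℝ i)))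

variable {N : ℕ} {s ε : ℝ}

lemma fracLapConst_nonneg (hs0 : 0 < s) (hs1 : s < 1) : 0 ≤ fracLapConst N s := by
  have h1 : 0 < Real.Gamma (1 - s) := Real.Gamma_pos_of_pos (by linarith)
  have h2 : 0 < Real.Gamma ((N + 2 * s) / 2) := Real.Gamma_pos_of_pos (by positivity)
  unfold fracLapConst
  positivity

lemma measurableSet_le_norm (ε : ℝ) :
    MeasurableSet {z : EuclideanSpace ℝ (Fin N) | ε ≤ ‖z‖} :=
  measurableSet_le measurable_const measurable_norm

lemma measurable_truncatedKernel : Measurable (truncatedKernel N s ε) :=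
  (measurable_const.div (measurable_norm.pow_const _)).indicator (measurableSet_le_norm ε)

lemma truncatedKernel_nonneg (hs0 : 0 < s) (hs1 : s < 1) (z : EuclideanSpace ℝ (Fin N)) :
    0 ≤ truncatedKernel N s ε z :=
  Set.indicator_nonneg (fun _ _ => div_nonneg (fracLapConst_nonneg hs0 hs1) (by positivity)) z

/-- Used with the truncation radius for integrability of the kernel, where the constant may blow up
as `ε → 0`, and with radius `1` for the tail bound, where it is `2^(γ/2)` for every `ε`. -/
lemma inv_norm_rpow_le_psiWeight {γ : ℝ} (hγ : 0 ≤ γ) (hε : 0 < ε)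
    {z : EuclideanSpace ℝ (Fin N)} (hz : ε ≤ ‖z‖) :
    1 / ‖z‖ ^ γ ≤ (1 + (ε ^ 2)⁻¹) ^ (γ / 2) * psiWeight γ z := by
  have hz0 : 0 < ‖z‖ := hε.trans_le hz
  have h1 : 1 + ‖z‖ ^ 2 ≤ (1 + (ε ^ 2)⁻¹) * ‖z‖ ^ 2 := by
    have : 1 ≤ (ε ^ 2)⁻¹ * ‖z‖ ^ 2 := by
      rw [inv_mul_eq_div, le_div_iff₀ (by positivity), one_mul]; gcongr
    linarith
  have h2 : (1 + ‖z‖ ^ 2) ^ (γ / 2) ≤ (1 + (ε ^ 2)⁻¹) ^ (γ / 2) * ‖z‖ ^ γ := by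
    have e : ‖z‖ ^ γ = (‖z‖ ^ 2) ^ (γ / 2) := by
      rw [← Real.rpow_natCast, ← Real.rpow_mul hz0.le]; congr 1; push_cast; ring
    rw [e, ← Real.mul_rpow (by positivity) (by positivity)]
    exact Real.rpow_le_rpow (by positivity) h1 (by positivity)
  have h3 : psiWeight γ z = ((1 + ‖z‖ ^ 2) ^ (γ / 2))⁻¹ := by
    rw [psiWeight, ← Real.rpow_neg (by positivity), neg_div]
  rw [h3, ← div_eq_mul_inv, div_le_div_iff₀ (by positivity) (by positivity), one_mul]
  exact h2

lemma truncatedKernel_le_psiWeight (hs0 : 0 < s) (hs1 : s < 1) (hε : 0 < ε)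
    (z : EuclideanSpace ℝ (Fin N)) :
    truncatedKernel N s ε z ≤
      fracLapConst N s * (1 + (ε ^ 2)⁻¹) ^ (((N : ℝ) + 2 * s) / 2) * psiWeight (N + 2 * s) z := by
  have hC := fracLapConst_nonneg (N := N) hs0 hs1
  have hψ := psiWeight_pos ((N : ℝ) + 2 * s) z
  refine Set.indicator_le' (g := fun z => fracLapConst N s * (1 + (ε ^ 2)⁻¹) ^
    (((N : ℝ) + 2 * s) / 2) * psiWeight (N + 2 * s) z) (fun z hz => ?_) (fun z _ => ?_) z
  · rw [div_eq_mul_one_div, mul_assoc]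
    exact mul_le_mul_of_nonneg_left (inv_norm_rpow_le_psiWeight (by positivity) hε hz) hC
  · have := psiWeight_pos ((N : ℝ) + 2 * s) z
    positivity

lemma integrable_truncatedKernel (hs0 : 0 < s) (hs1 : s < 1) (hε : 0 < ε) :
    Integrable (truncatedKernel N s ε) := by
  refine ((integrable_psiWeight (N := N) (γ := N + 2 * s) (by linarith)).const_mul
    (fracLapConst N s * (1 + (ε ^ 2)⁻¹) ^ (((N : ℝ) + 2 * s) / 2))).mono'
    measurable_truncatedKernel.aestronglyMeasurable (Eventually.of_forall fun z => ?_)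
  rw [Real.norm_of_nonneg (truncatedKernel_nonneg hs0 hs1 z)]
  exact truncatedKernel_le_psiWeight hs0 hs1 hε z

lemma isFiniteMeasure_mixedJumpMeasure (hs0 : 0 < s) (hs1 : s < 1) (hε : 0 < ε) :
    IsFiniteMeasure (mixedJumpMeasure N s ε) := by
  have := isFiniteMeasure_withDensity_ofReal
    (integrable_truncatedKernel (N := N) hs0 hs1 hε).hasFiniteIntegral
  have h2 : IsFiniteMeasure (ENNReal.ofReal (ε ^ 2)⁻¹ •
      ∑ i, (Measure.dirac (ε • EuclideanSpace.basisFun (Fin N) ℝ i) +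
      Measure.dirac (-(ε • EuclideanSpace.basisFun (Fin N) ℝ i)))) :=
    Measure.smul_finite _ ENNReal.ofReal_ne_top
  unfold mixedJumpMeasure
  infer_instance

lemma integral_mixedJumpMeasure (hs0 : 0 < s) (hs1 : s < 1)
    {f : EuclideanSpace ℝ (Fin N) → ℝ} (hf : Integrable f (mixedJumpMeasure N s ε)) :
    ∫ z, f z ∂(mixedJumpMeasure N s ε) = (∫ z, truncatedKernel N s ε z * f z) +
      ∑ i, (ε ^ 2)⁻¹ * (f (ε • EuclideanSpace.basisFun (Fin N) ℝ i) +
        f (-(ε • EuclideanSpace.basisFun (Fin N) ℝ i))) := by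
  have hd : ∀ a : EuclideanSpace ℝ (Fin N), Integrable f (Measure.dirac a) := fun a =>
    integrable_dirac (by simp)
  unfold mixedJumpMeasure at hf ⊢
  rw [integral_add_measure hf.left_of_add_measure hf.right_of_add_measure,
    integral_smul_measure, integral_finsetSum_measure fun i _ => (hd _).add_measure (hd _),
    integral_withDensity_eq_integral_toReal_smul measurable_truncatedKernel.ennreal_ofReal
      (Eventually.of_forall fun z => ENNReal.ofReal_lt_top),
    ENNReal.toReal_ofReal (by positivity), smul_eq_mul, Finset.mul_sum]
  congr 1
  · refine integral_congr_ae (Eventually.of_forall fun z => ?_)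
    simp [ENNReal.toReal_ofReal (truncatedKernel_nonneg hs0 hs1 z)]
  · refine Finset.sum_congr rfl fun i _ => ?_
    rw [integral_add_measure (hd _) (hd _), integral_dirac, integral_dirac]

/-- In polar coordinates the radial integrand is `r^(1 - 2s)`, integrable at `0` because `s < 1`. -/
lemma integrableOn_norm_rpow_ball (hN : 1 ≤ N) (hs1 : s < 1) :
    IntegrableOn (fun z : EuclideanSpace ℝ (Fin N) => ‖z‖ ^ 2 / ‖z‖ ^ ((N : ℝ) + 2 * s))
      (Metric.ball 0 1) := by
  have : Nonempty (Fin N) := ⟨⟨0, hN⟩⟩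
  have hnt : Nontrivial (EuclideanSpace ℝ (Fin N)) := inferInstance
  rw [← integrable_indicator_iff Metric.isOpen_ball.measurableSet]
  have h := (integrable_fun_norm_addHaar (volume : Measure (EuclideanSpace ℝ (Fin N)))
    (f := (Set.Iio (1 : ℝ)).indicator fun r => r ^ 2 / r ^ ((N : ℝ) + 2 * s))).2 ?_
  · refine h.congr (Eventually.of_forall fun z => ?_)
    simp [Set.indicator]
  · have h1 : IntegrableOn (fun r : ℝ => r ^ (1 - 2 * s)) (Set.Ioo 0 1) :=
      (intervalIntegral.integrableOn_Ioo_rpow_iff one_pos).2 (by linarith)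
    have h2 : IntegrableOn ((Set.Iio (1 : ℝ)).indicator fun r => r ^ (1 - 2 * s)) (Set.Ioi 0) := by
      rw [IntegrableOn, integrable_indicator_iff measurableSet_Iio, IntegrableOn,
        Measure.restrict_restrict measurableSet_Iio, Set.inter_comm, Set.Ioi_inter_Iio]
      exact h1
    refine h2.congr_fun (fun r hr => ?_) measurableSet_Ioi
    have hr0 : 0 < r := hr
    by_cases hr1 : r < 1
    · have e : r ^ (N - 1) * (r ^ 2 / r ^ ((N : ℝ) + 2 * s)) = r ^ (1 - 2 * s) := by
        rw [← Real.rpow_natCast, ← Real.rpow_natCast, ← Real.rpow_sub hr0, ← Real.rpow_add hr0]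
        congr 1
        push_cast [hN]; ring
      simp [Set.indicator, hr1, e]
    · simp [Set.indicator, hr1]

/-- The approximating measures form a uniform family of jump measures. -/
lemma isJumpMeasure_mixed (hN : 1 ≤ N) (hs0 : 0 < s) (hs1 : s < 1) (hε : 0 < ε) (hε1 : ε < 1) :
    IsJumpMeasure (N + 2 * s)
      (fracLapConst N s * (∫ z in Metric.ball (0 : EuclideanSpace ℝ (Fin N)) 1,
        ‖z‖ ^ 2 / ‖z‖ ^ ((N : ℝ) + 2 * s)) + 2 * N)
      (fracLapConst N s * 2 ^ (((N : ℝ) + 2 * s) / 2)) (mixedJumpMeasure N s ε) := by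
  have hfin := isFiniteMeasure_mixedJumpMeasure (N := N) hs0 hs1 hε
  have hC := fracLapConst_nonneg (N := N) hs0 hs1
  have hnorm : ∀ i, ‖ε • EuclideanSpace.basisFun (Fin N) ℝ i‖ = ε := fun i => by
    rw [norm_smul, (EuclideanSpace.basisFun (Fin N) ℝ).norm_eq_one, mul_one,
      Real.norm_of_nonneg hε.le]
  refine ⟨hfin, ⟨?_⟩, ?_, ?_⟩
  · have hk : ∀ z, truncatedKernel N s ε (-z) = truncatedKernel N s ε z := fun z => by
      simp [truncatedKernel, Set.indicator]
    unfold mixedJumpMeasure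
    rw [Measure.neg, Measure.map_add _ _ measurable_neg, Measure.map_smul,
      Measure.map_finset_sum measurable_neg.aemeasurable]
    congr 1
    · ext S hS
      rw [Measure.map_apply measurable_neg hS, withDensity_apply _ hS,
        withDensity_apply _ (measurable_neg hS), ← lintegral_indicator hS,
        ← lintegral_indicator (measurable_neg hS),
        ← lintegral_neg_eq_self (S.indicator _)]
      refine lintegral_congr fun z => ?_
      simp [Set.indicator, hk, Set.mem_neg]
      rfl
    · congr 1
      refine Finset.sum_congr rfl fun i _ => ?_
      rw [Measure.map_add _ _ measurable_neg, Measure.map_dirac' measurable_neg,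
        Measure.map_dirac' measurable_neg, neg_neg, add_comm]
  · have hi : Integrable ((Metric.ball 0 1).indicator
        fun z : EuclideanSpace ℝ (Fin N) => ‖z‖ ^ 2) (mixedJumpMeasure N s ε) := by
      rw [integrable_indicator_iff Metric.isOpen_ball.measurableSet]
      exact ((continuous_norm.pow 2).continuousOn.integrableOn_compact
        (isCompact_closedBall 0 1)).mono_set Metric.ball_subset_closedBall
    rw [← integral_indicator Metric.isOpen_ball.measurableSet, integral_mixedJumpMeasure hs0 hs1 hi]
    refine add_le_add ?_ (le_of_eq ?_)
    · rw [← integral_indicator Metric.isOpen_ball.measurableSet, ← integral_const_mul]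
      refine integral_mono_of_nonneg (Eventually.of_forall fun z => ?_)
        (((integrable_indicator_iff Metric.isOpen_ball.measurableSet).2
          (integrableOn_norm_rpow_ball hN hs1)).const_mul _) (Eventually.of_forall fun z => ?_)
      · exact mul_nonneg (truncatedKernel_nonneg hs0 hs1 z)
          (Set.indicator_nonneg (fun _ _ => by positivity) _)
      · by_cases hz : z ∈ Metric.ball 0 1
        · simp only [Set.indicator_of_mem hz]
          by_cases hz2 : z ∈ {z : EuclideanSpace ℝ (Fin N) | ε ≤ ‖z‖}
          · rw [truncatedKernel, Set.indicator_of_mem hz2]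
            exact le_of_eq (by ring)
          · rw [truncatedKernel, Set.indicator_of_notMem hz2]
            rw [zero_mul]
            exact mul_nonneg hC (by positivity)
        · simp only [Set.indicator_of_notMem hz]
          simp
    -- Each of the `2N` atoms has mass `ε⁻²` and sits at distance `ε`, so it contributes exactly `1`
    -- to the second moment.
    · have hterm : ∀ i, (ε ^ 2)⁻¹ * ((Metric.ball 0 1).indicator
          (fun z : EuclideanSpace ℝ (Fin N) => ‖z‖ ^ 2)
            (ε • EuclideanSpace.basisFun (Fin N) ℝ i) +
          (Metric.ball 0 1).indicator (fun z : EuclideanSpace ℝ (Fin N) => ‖z‖ ^ 2)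
            (-(ε • EuclideanSpace.basisFun (Fin N) ℝ i))) = 2 := fun i => by
        rw [Set.indicator_of_mem (by rw [mem_ball_zero_iff, hnorm]; exact hε1),
          Set.indicator_of_mem (by rw [mem_ball_zero_iff, norm_neg, hnorm]; exact hε1), norm_neg,
          hnorm]
        field_simp
        norm_num
      rw [Finset.sum_congr rfl fun i _ => hterm i]
      simp [mul_comm]
  · refine Measure.le_iff.2 fun S hS => ?_
    have hb : MeasurableSet (S ∩ (Metric.ball (0 : EuclideanSpace ℝ (Fin N)) 1)ᶜ) :=
      hS.inter Metric.isOpen_ball.measurableSet.compl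
    rw [Measure.restrict_apply hS]
    unfold mixedJumpMeasure
    -- All atoms lie inside the unit ball since `ε < 1`, so the tail sees only the kernel.
    have hz : (ENNReal.ofReal (ε ^ 2)⁻¹ •
        ∑ i, (Measure.dirac (ε • EuclideanSpace.basisFun (Fin N) ℝ i) +
        Measure.dirac (-(ε • EuclideanSpace.basisFun (Fin N) ℝ i))))
        (S ∩ (Metric.ball (0 : EuclideanSpace ℝ (Fin N)) 1)ᶜ) = 0 := by
      rw [Measure.smul_apply, Measure.finsetSum_apply, Finset.sum_eq_zero, smul_zero]
      intro i _
      have h1 : ε • EuclideanSpace.basisFun (Fin N) ℝ i ∉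
          S ∩ (Metric.ball (0 : EuclideanSpace ℝ (Fin N)) 1)ᶜ := fun h =>
        h.2 (by rw [mem_ball_zero_iff, hnorm]; exact hε1)
      have h2 : -(ε • EuclideanSpace.basisFun (Fin N) ℝ i) ∉
          S ∩ (Metric.ball (0 : EuclideanSpace ℝ (Fin N)) 1)ᶜ := fun h =>
        h.2 (by rw [mem_ball_zero_iff, norm_neg, hnorm]; exact hε1)
      rw [Measure.add_apply, Measure.dirac_apply' _ hb, Measure.dirac_apply' _ hb,
        Set.indicator_of_notMem h1, Set.indicator_of_notMem h2, add_zero]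
    rw [Measure.add_apply, hz, add_zero, withDensity_apply _ hb, withDensity_apply _ hS]
    refine (setLIntegral_mono' hb fun z hz => ENNReal.ofReal_le_ofReal ?_).trans
      (lintegral_mono_set Set.inter_subset_left)
    have hz1 : 1 ≤ ‖z‖ := by simpa using hz.2
    have hz2 : z ∈ {z : EuclideanSpace ℝ (Fin N) | ε ≤ ‖z‖} := hε1.le.trans hz1
    rw [truncatedKernel, Set.indicator_of_mem hz2, div_eq_mul_one_div, mul_assoc]
    have := inv_norm_rpow_le_psiWeight (γ := (N : ℝ) + 2 * s) (by positivity) one_pos hz1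
    norm_num at this ⊢
    exact mul_le_mul_of_nonneg_left this hC

/-- The jump operators converge to `Δ - (-Δ)^s` on classical functions. -/
lemma tendsto_jumpOp_mixed (hN : 1 ≤ N) (hs0 : 0 < s) (hs1 : s < 1)
    {u : EuclideanSpace ℝ (Fin N) → ℝ} (hu : ContDiff ℝ 2 u)
    (hui : Integrable fun x => u x * psiWeight (N + 2 * s) x) {x : EuclideanSpace ℝ (Fin N)} {v : ℝ}
    (hv : HasFracLaplacianAt s u x v) :
    Tendsto (fun ε => jumpOp (mixedJumpMeasure N s ε) u x) (𝓝[>] 0)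
      (𝓝 (Laplacian.laplacian u x - v)) := by
  have hL : Laplacian.laplacian u x =
      ∑ i, fderiv ℝ (fderiv ℝ u) x (EuclideanSpace.basisFun (Fin N) ℝ i)
        (EuclideanSpace.basisFun (Fin N) ℝ i) := by
    rw [InnerProductSpace.laplacian_eq_iteratedFDeriv_orthonormalBasis u
      (EuclideanSpace.basisFun (Fin N) ℝ)]
    simp [iteratedFDeriv_two_apply]
  have h1 := tendsto_finsetSum (M := ℝ) Finset.univ fun i _ =>
    tendsto_second_difference hu x (EuclideanSpace.basisFun (Fin N) ℝ i)
  rw [← hL] at h1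
  -- For every `ε` in `(0, 1)` the jump operator is exactly the sum of second difference quotients
  -- minus the truncated singular integral, so no further limit is needed.
  refine (h1.sub hv).congr' ?_
  filter_upwards [Ioo_mem_nhdsGT one_pos] with ε hε
  have hj := isJumpMeasure_mixed hN hs0 hs1 hε.1 hε.2
  have hfin := hj.finite
  have hint : Integrable (fun z => u (x + z) - u x) (mixedJumpMeasure N s ε) :=
    (hj.integrable_shift (by positivity) (mul_nonneg (fracLapConst_nonneg hs0 hs1) (by positivity))
      hu.continuous hui x).sub (integrable_const _)
  rw [jumpOp, integral_mixedJumpMeasure hs0 hs1 hint]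
  refine (sub_eq_add_neg _ _).trans ((add_comm _ _).trans (congrArg₂ (· + ·) ?_ ?_))
  · have hm : MeasurableSet {y : EuclideanSpace ℝ (Fin N) | ε ≤ ‖x - y‖} :=
      measurableSet_le measurable_const (measurable_const.sub measurable_id).norm
    rw [← integral_const_mul, ← integral_indicator hm, ← integral_neg,
      ← integral_add_left_eq_self _ x]
    refine integral_congr_ae (Eventually.of_forall fun z => ?_)
    by_cases hz : ε ≤ ‖z‖
    · simp [truncatedKernel, Set.indicator, hz]
      ring
    · simp [truncatedKernel, Set.indicator, hz]
  · refine Finset.sum_congr rfl fun i _ => ?_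
    rw [← sub_eq_add_neg x]; ring

end

/-! ### Kato's inequality and the weighted energy estimate. -/

noncomputable section

/-- Kato-type inequality for jump operators and `t ↦ |t|^p`. -/
lemma IsJumpMeasure.subgradient_mul_jumpOp_le {N : ℕ} {γ A B : ℝ}
    {μ : Measure (EuclideanSpace ℝ (Fin N))} (h : IsJumpMeasure γ A B μ) (hγ : 0 ≤ γ) (hB : 0 ≤ B)
    {p : ℝ} (hp : 1 ≤ p) {u : EuclideanSpace ℝ (Fin N) → ℝ} (hu : Continuous u)
    (hui : Integrable fun x => u x * psiWeight γ x)
    (hwi : Integrable fun x => |u x| ^ p * psiWeight γ x) (x : EuclideanSpace ℝ (Fin N)) :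
    absRpowSubgradient p (u x) * jumpOp μ u x ≤ jumpOp μ (fun x => |u x| ^ p) x := by
  have := h.finite
  have hw : Continuous fun x => |u x| ^ p :=
    hu.abs.rpow_const fun _ => Or.inr (by linarith)
  rw [jumpOp, jumpOp, ← integral_const_mul]
  exact integral_mono (((h.integrable_shift hγ hB hu hui x).sub (integrable_const _)).const_mul _)
    ((h.integrable_shift hγ hB hw hwi x).sub (integrable_const _))
    fun z => absRpowSubgradient_le hp _ _

/-- The weighted energy inequality for classical solutions, tested with a cutoff of the weight. -/
lemma exists_weighted_inequality (N : ℕ) (hN : 1 ≤ N) (s : ℝ) (hs0 : 0 < s) (hs1 : s < 1) :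
    ∃ K : ℝ, ∀ (q u : EuclideanSpace ℝ (Fin N) → ℝ) (p : ℝ), Continuous q → 1 ≤ p →
      ContDiff ℝ 2 u → (∀ x, ∃ v, HasFracLaplacianAt s u x v ∧
        Laplacian.laplacian u x - v = q x * u x) →
      Integrable (fun x => u x * psiWeight (N + 2 * s) x) →
      Integrable (fun x => |u x| ^ p * psiWeight (N + 2 * s) x) →
      ∀ δ : ℝ, 0 < δ →
        Integrable (fun x => psiCutoff (N + 2 * s) δ x * (p * q x * |u x| ^ p)) ∧
        ∫ x, psiCutoff (N + 2 * s) δ x * (p * q x * |u x| ^ p) ≤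
          K * ∫ x, |u x| ^ p * psiWeight (N + 2 * s) x := by
  set γ : ℝ := N + 2 * s with hγdef
  have hγ0 : 0 < γ := by positivity
  have hγN : (N : ℝ) < γ := by linarith
  obtain ⟨M, hM, hM2⟩ := psiCutoff_second_difference_le (N := N) hγ0.le
  set A : ℝ := fracLapConst N s * (∫ z in Metric.ball (0 : EuclideanSpace ℝ (Fin N)) 1,
        ‖z‖ ^ 2 / ‖z‖ ^ γ) + 2 * N with hA
  set B : ℝ := fracLapConst N s * 2 ^ (γ / 2) with hBdef
  have hB : 0 ≤ B := mul_nonneg (fracLapConst_nonneg hs0 hs1) (by positivity)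
  -- The constant of `IsJumpMeasure.jumpOp_le`; it involves none of `ε`, `δ`, `p`, `q`, `u`.
  set K : ℝ := M * A / 2 + B * (4 ^ (γ / 2) *
    (2 * ∫ z : EuclideanSpace ℝ (Fin N), psiWeight γ z)) with hK
  refine ⟨K, fun q u p hq hp hu heq hui hwi δ hδ => ?_⟩
  have huc := hu.continuous
  have hw : Continuous fun x => |u x| ^ p := huc.abs.rpow_const fun _ => Or.inr (by linarith)
  have hφ := continuous_psiCutoff (N := N) γ δ
  have hφ0 := psiCutoff_nonneg (N := N) γ δ
  have hφψ := psiCutoff_le (N := N) γ hδ.le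
  obtain ⟨R, hR0, hR⟩ := exists_psiCutoff_eq_zero (N := N) hγ0 hδ
  have hjump : ∀ ε ∈ Set.Ioo (0 : ℝ) 1, IsJumpMeasure γ A B (mixedJumpMeasure N s ε) :=
    fun ε hε => isJumpMeasure_mixed hN hs0 hs1 hε.1 hε.2
  have hcpt : HasCompactSupport fun x => psiCutoff γ δ x * (p * q x * |u x| ^ p) :=
    HasCompactSupport.intro (isCompact_closedBall (0 : EuclideanSpace ℝ (Fin N)) R) fun x hx => by
      rw [hR x (by simpa using hx), zero_mul]
  have hint : Integrable fun x => psiCutoff γ δ x * (p * q x * |u x| ^ p) :=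
    (hφ.mul ((continuous_const.mul hq).mul hw)).integrable_of_hasCompactSupport hcpt
  refine ⟨hint, ?_⟩
  obtain ⟨D, hD⟩ := (isCompact_closedBall (0 : EuclideanSpace ℝ (Fin N)) R).exists_bound_of_continuousOn
    huc.continuousOn
  obtain ⟨M', hM', hM2'⟩ := exists_second_difference_le hu R
  have hD0 : 0 ≤ D := (norm_nonneg _).trans (hD 0 (by simpa using hR0))
  have hψint : 0 ≤ ∫ z : EuclideanSpace ℝ (Fin N), psiWeight γ z :=
    integral_nonneg fun z => (psiWeight_pos γ z).le
  have huint : 0 ≤ ∫ z, |u z| * psiWeight γ z :=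
    integral_nonneg fun z => mul_nonneg (abs_nonneg _) (psiWeight_pos γ z).le
  -- A bound for the jump operators on `u`, uniform in `ε` and in `‖x‖ ≤ R`. It may depend on `u`
  -- and `δ`, since it serves only to dominate the limit `ε → 0`.
  set J : ℝ := M' * A / 2 + B * ((2 * (1 + R ^ 2)) ^ (γ / 2) *
      (∫ z, |u z| * psiWeight γ z) +
      D * ∫ z : EuclideanSpace ℝ (Fin N), psiWeight γ z) with hJ
  have hJb : ∀ ε ∈ Set.Ioo (0 : ℝ) 1, ∀ x : EuclideanSpace ℝ (Fin N), ‖x‖ ≤ R →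
      |jumpOp (mixedJumpMeasure N s ε) u x| ≤ J := fun ε hε x hx => by
    refine ((hjump ε hε).abs_jumpOp_le hγN hB hM' huc hui x fun z hz => hM2' x z hx hz).trans ?_
    have hDx : |u x| ≤ D := hD x (by simpa using hx)
    rw [hJ]
    gcongr
  set F : ℝ → EuclideanSpace ℝ (Fin N) → ℝ := fun ε x =>
    psiCutoff γ δ x * (absRpowSubgradient p (u x) * jumpOp (mixedJumpMeasure N s ε) u x) with hF
  have hFm : ∀ ε ∈ Set.Ioo (0 : ℝ) 1, AEStronglyMeasurable (F ε) := fun ε hε =>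
    hφ.aestronglyMeasurable.mul
      (((measurable_absRpowSubgradient p).comp huc.measurable).aestronglyMeasurable.mul
        ((hjump ε hε).stronglyMeasurable_jumpOp huc).aestronglyMeasurable)
  set bound : EuclideanSpace ℝ (Fin N) → ℝ :=
    (Metric.closedBall 0 R).indicator fun _ => p * D ^ (p - 1) * J with hbound
  have hbi : Integrable bound :=
    (integrable_indicator_iff measurableSet_closedBall).2
      (integrableOn_const (measure_closedBall_lt_top).ne)
  have hFb : ∀ ε ∈ Set.Ioo (0 : ℝ) 1, ∀ x, ‖F ε x‖ ≤ bound x := fun ε hε x => by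
    by_cases hx : ‖x‖ ≤ R
    · have hDx : |u x| ≤ D := hD x (by simpa using hx)
      rw [hbound, Set.indicator_of_mem (by simpa using hx), hF, norm_mul, norm_mul,
        Real.norm_of_nonneg (hφ0 x), Real.norm_eq_abs, Real.norm_eq_abs]
      have h1 : psiCutoff γ δ x ≤ 1 := (hφψ x).trans (psiWeight_le_one hγ0.le x)
      calc _ ≤ 1 * (|absRpowSubgradient p (u x)| * |jumpOp (mixedJumpMeasure N s ε) u x|) := by
            gcongr
        _ ≤ _ := by
            rw [one_mul]
            exact mul_le_mul (abs_absRpowSubgradient_le hp hDx) (hJb ε hε x hx) (abs_nonneg _)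
              (by positivity)
    · rw [hbound, Set.indicator_of_notMem (by simpa using hx)]
      simp [hF, hR x (not_le.1 hx)]
  have hmem : ∀ᶠ ε in 𝓝[>] (0 : ℝ), ε ∈ Set.Ioo (0 : ℝ) 1 := Ioo_mem_nhdsGT one_pos
  -- The limit is taken before Kato's inequality is applied, on an expression where the operator
  -- acts on `u` and not on `|u|^p`.
  have hlim : Tendsto (fun ε => ∫ x, F ε x) (𝓝[>] 0)
      (𝓝 (∫ x, psiCutoff γ δ x * (p * q x * |u x| ^ p))) := by
    refine tendsto_integral_filter_of_dominated_convergence bound (hmem.mono hFm)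
      (hmem.mono fun ε hε => Eventually.of_forall (hFb ε hε)) hbi
      (Eventually.of_forall fun x => ?_)
    obtain ⟨v, hv, hLv⟩ := heq x
    have h1 := ((tendsto_jumpOp_mixed hN hs0 hs1 hu hui hv).const_mul
      (absRpowSubgradient p (u x))).const_mul (psiCutoff γ δ x)
    have h2 : absRpowSubgradient p (u x) * (Laplacian.laplacian u x - v) =
        p * q x * |u x| ^ p := by
      rw [hLv, mul_left_comm, absRpowSubgradient_mul_self hp]; ring
    rw [h2] at h1
    exact h1
  refine le_of_tendsto hlim (hmem.mono fun ε hε => ?_)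
  have hj := hjump ε hε
  obtain ⟨i1, i2, e⟩ := hj.integral_mul_jumpOp hγN hB hφ hφ0 hφψ hw hwi
  calc ∫ x, F ε x
      ≤ ∫ x, psiCutoff γ δ x * jumpOp (mixedJumpMeasure N s ε) (fun x => |u x| ^ p) x :=
        integral_mono (hbi.mono' (hFm ε hε) (Eventually.of_forall (hFb ε hε))) i1 fun x =>
          mul_le_mul_of_nonneg_left
            (hj.subgradient_mul_jumpOp_le hγ0.le hB hp huc hui hwi x) (hφ0 x)
    _ = ∫ x, |u x| ^ p * jumpOp (mixedJumpMeasure N s ε) (psiCutoff γ δ) x := e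
    _ ≤ ∫ x, K * (|u x| ^ p * psiWeight γ x) :=
        integral_mono i2 (hwi.const_mul K) fun x => by
          have := mul_le_mul_of_nonneg_left
            (hj.jumpOp_le hγN hB hM hφ hφ0 hφψ (hM2 δ hδ.le) x)
            (by positivity : 0 ≤ |u x| ^ p)
          rw [← hK] at this
          exact this.trans_eq (by ring)
    _ = _ := integral_const_mul _ _

end

/-! ### Vanishing of the weighted integral. -/

theorem corollary2p7 (N : ℕ) (hN : 1 ≤ N) (s : ℝ) (hs0 : 0 < s) (hs1 : s < 1)
    (β : ℝ) (hβ0 : 0 < β) (hβ : β ≤ N + 2 * s) (C₀ : ℝ) (hC₀ : 0 < C₀) :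
    ∃ K : ℝ, ∀ ρ c : EuclideanSpace ℝ (Fin N) → ℝ,
      DensityCondition 0 C₀ ρ → PotentialCondition c →
      ∀ c₀ : ℝ, 0 < c₀ → (∀ x, c₀ ≤ c x) →
      ∀ p : ℝ, 1 ≤ p → K < p * c₀ →
      ∀ u : EuclideanSpace ℝ (Fin N) → ℝ,
        IsClassicalSolution s ρ c u →
        MemLs s (fun x => |u x| ^ p) →
        MemWeightedLp p (psiWeight β) u →
        ∀ x, u x = 0 := by
  obtain ⟨K, hK⟩ := exists_weighted_inequality N hN s hs0 hs1
  -- With `q = ρ c ≥ C₀ c₀`, the condition `p c₀ > K / C₀` says that `p C₀ c₀` exceeds the energy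
  -- constant.
  refine ⟨K / C₀, fun ρ c hρ hc c₀ hc₀ hcc p hp hKp u hu hwLs _ => ?_⟩
  have hucont := hu.contDiff.continuous
  have hw : Continuous fun x => |u x| ^ p := hucont.abs.rpow_const fun _ => Or.inr (by linarith)
  have hui := hu.memLs.integrable_mul_psiWeight hs0 hucont
  have hwi := hwLs.integrable_mul_psiWeight hs0 hw
  have hρ0 : ∀ x, C₀ ≤ ρ x := fun x => by simpa using hρ.lower_bound x
  set γ : ℝ := N + 2 * s
  set I : ℝ := ∫ x, |u x| ^ p * psiWeight γ x with hI
  have hmain : ∀ δ : ℝ, 0 < δ →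
      p * (C₀ * c₀) * ∫ x, |u x| ^ p * psiCutoff γ δ x ≤ K * I := fun δ hδ => by
    obtain ⟨i1, h1⟩ := hK (fun x => ρ x * c x) u p (hρ.continuous.mul hc.continuous) hp hu.contDiff
      (fun x => by
        obtain ⟨v, hv, hv2⟩ := hu.equation x
        exact ⟨v, hv, by linarith⟩) hui hwi δ hδ
    refine le_trans ?_ h1
    rw [← integral_const_mul]
    refine integral_mono_of_nonneg (Eventually.of_forall fun x => ?_) i1
      (Eventually.of_forall fun x => ?_)
    · have := psiCutoff_nonneg γ δ x
      positivity
    · have h2 : C₀ * c₀ ≤ ρ x * c x :=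
        mul_le_mul (hρ0 x) (hcc x) hc₀.le (hC₀.le.trans (hρ0 x))
      have h3 : 0 ≤ psiCutoff γ δ x * (p * |u x| ^ p) :=
        mul_nonneg (psiCutoff_nonneg γ δ x) (by positivity)
      have := mul_le_mul_of_nonneg_left h2 h3
      simp only
      linarith
  have hlim : Tendsto (fun δ => ∫ x, |u x| ^ p * psiCutoff γ δ x) (𝓝[>] 0) (𝓝 I) := by
    refine tendsto_integral_filter_of_dominated_convergence
      (fun x => |u x| ^ p * psiWeight γ x)
      (Eventually.of_forall fun δ => (hw.mul (continuous_psiCutoff γ δ)).aestronglyMeasurable)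
      ?_ hwi (Eventually.of_forall fun x => (tendsto_psiCutoff γ x).const_mul _)
    filter_upwards [self_mem_nhdsWithin] with δ hδ
    refine Eventually.of_forall fun x => ?_
    have h0 := psiCutoff_nonneg γ δ x
    rw [Real.norm_of_nonneg (by positivity)]
    gcongr
    exact psiCutoff_le γ (Set.mem_Ioi.1 hδ).le x
  have hle : p * (C₀ * c₀) * I ≤ K * I :=
    le_of_tendsto (hlim.const_mul _) (by
      filter_upwards [self_mem_nhdsWithin] with δ hδ using hmain δ hδ)
  have hnonneg : ∀ x, 0 ≤ |u x| ^ p * psiWeight γ x := fun x =>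
    mul_nonneg (by positivity) (psiWeight_pos γ x).le
  -- `I` is finite and nonnegative, and `(p C₀ c₀ - K) I ≤ 0` with a positive factor.
  have hI0 : I = 0 := by
    have h1 : 0 ≤ I := integral_nonneg hnonneg
    rw [div_lt_iff₀ hC₀] at hKp
    nlinarith
  have hae := (integral_eq_zero_iff_of_nonneg hnonneg hwi).1 hI0
  have hzero := (Continuous.ae_eq_iff_eq volume (hw.mul (continuous_psiWeight γ))
    continuous_zero).1 hae
  intro x
  have hx : |u x| ^ p * psiWeight γ x = 0 := congrFun hzero x
  have hx2 := (mul_eq_zero.1 hx).resolve_right (psiWeight_pos γ x).ne'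
  exact abs_eq_zero.1 ((Real.rpow_eq_zero (abs_nonneg _) (by linarith)).1 hx2)
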